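/- Let $\mathbb{k}$ be a field, let $p$ be a natural number and let $A=\mathbb{k}[x_{i,j}\mid 1\le i,j\le p]$. Write $\widetilde R$ for the ring $A$ with the $(\mathbb{Z}^p\oplus\mathbb{Z}^p)$-grading $\deg(x_{i,j})=\mathbf{e}_i\oplus(-\mathbf{e}_j)$, and $R$ for the ring $A$ with the $(\mathbb{Z}^p\oplus\mathbb{Z}^p)$-grading $\deg(x_{i,j})=\mathbf{e}_i\oplus\mathbf{e}_j$. Let $t_1,\ldots,t_p,s_1,\ldots,s_p$ be variables over $\mathbb{Z}$, where $t_i$ corresponds to $\mathbf{e}_i\oplus\mathbf{0}$ and $s_i$ to $\mathbf{0}\oplus\mathbf{e}_i$. For $S\in\{\widetilde R,R\}$ and an $S$-homogeneous ideal $I$, let $F_\bullet$ be a finite graded free $S$-resolution of $S/I$ with $F_i=\bigoplus_j S(-\mathbf{a}_{i,j},-\mathbf{b}_{i,j})$ of finite rank. The K-polynomial of $S/I$ is the Laurent polynomial $\mathcal{K}(S/I;\mathbf{t},\mathbf{s})=\sum_i(-1)^i\sum_j\mathbf{t}^{\mathbf{a}_{i,j}}\mathbf{s}^{\mathbf{b}_{i,j}}$;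 such a resolution always exists, and the K-polynomial does not depend on it. The multidegree polynomial $\mathcal{C}(S/I;\mathbf{t},\mathbf{s})\in\mathbb{Z}[\mathbf{t},\mathbf{s}]$ is the sum of all terms of total degree $\operatorname{codim}(S/I)=p^2-\dim(S/I)$ in the power series expansion of $\mathcal{K}(S/I;\mathbf{1}-\mathbf{t},\mathbf{1}-\mathbf{s})$ (it is $0$ if $I$ is the unit ideal). Let $I\subset A$ be an $\widetilde R$-homogeneous ideal. Then $I$ is also $R$-homogeneous, and $$\mathcal{C}(\widetilde R/I;t_1,\ldots,t_p,s_1,\ldots,s_p)=\mathcal{C}(R/I;t_1,\ldots,t_p,-s_1,\ldots,-s_p).$$ -/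

import Mathlib

open scoped BigOperators

noncomputable section

namespace Multidegree

open MvPolynomial

attribute [local instance] MvPolynomial.weightedGradedAlgebra

variable {k σ τ : Type*} [Field k] [Fintype σ] [Fintype τ] [DecidableEq τ]

/-- `I` is homogeneous for the `ℤ^τ`-grading of `k[x_a | a ∈ σ]` with `deg x_a = w a`. -/
def IsGradedIdeal (w : σ → (τ → ℤ)) (I : Ideal (MvPolynomial σ k)) : Prop :=
  I.IsHomogeneous (weightedHomogeneousSubmodule k w)

/-- A `ℤ^τ`-graded free resolution `0 → F_len → ⋯ → F_1 → F_0 → A/I → 0` of `A/I`, of finite length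
and with all `F_i` of finite rank, where `A = k[x_a | a ∈ σ]` is graded by `deg x_a = w a`.

`F_i = ⨁_j A(-shift i j)` is the free module `A^(rank i)` whose `j`-th basis vector is placed in
degree `shift i j`; all maps preserve degrees. -/
structure GradedFreeResolution (w : σ → (τ → ℤ)) (I : Ideal (MvPolynomial σ k)) where
  /-- the length of the resolution -/
  len : ℕ
  /-- the rank of `F_i` -/
  rank : ℕ → ℕ
  /-- `F_i = 0` beyond the length -/
  rank_eq_zero : ∀ i, len < i → rank i = 0
  /-- the degrees of the basis vectors of `F_i` -/
  shift : ∀ i, Fin (rank i) → (τ → ℤ)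
  /-- the differential `F_{i+1} → F_i` -/
  d : ∀ i, (Fin (rank (i + 1)) → MvPolynomial σ k) →ₗ[MvPolynomial σ k]
    (Fin (rank i) → MvPolynomial σ k)
  /-- the augmentation `F_0 → A/I` -/
  aug : (Fin (rank 0) → MvPolynomial σ k) →ₗ[MvPolynomial σ k] (MvPolynomial σ k ⧸ I)
  /-- the `j`-th basis vector of `F_{i+1}` goes to an element of degree `shift (i+1) j` of `F_i` -/
  d_homogeneous : ∀ i (j : Fin (rank (i + 1))) (l : Fin (rank i)),
    IsWeightedHomogeneous w (d i (Pi.single j 1) l) (shift (i + 1) j - shift i l)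
  /-- the `j`-th basis vector of `F_0` goes to an element of degree `shift 0 j` of `A/I` -/
  aug_homogeneous : ∀ j : Fin (rank 0), ∃ f : MvPolynomial σ k,
    IsWeightedHomogeneous w f (shift 0 j) ∧ aug (Pi.single j 1) = Ideal.Quotient.mk I f
  aug_surjective : Function.Surjective aug
  exact_zero : Function.Exact (d 0) aug
  exact_succ : ∀ i, Function.Exact (d (i + 1)) (d i)

/-- The Laurent polynomial `∑_i (-1)^i [F_i]_t`, where `[F_i]_t = ∑_j t^(shift i j)`. Laurent
polynomials in `(t_i)_{i ∈ τ}` are elements of the group ring `ℤ[ℤ^τ]`. -/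
def GradedFreeResolution.kPoly {w : σ → (τ → ℤ)} {I : Ideal (MvPolynomial σ k)}
    (F : GradedFreeResolution w I) : AddMonoidAlgebra ℤ (τ → ℤ) :=
  ∑ i ∈ Finset.range (F.len + 1), (-1 : ℤ) ^ i •
    ∑ j : Fin (F.rank i), AddMonoidAlgebra.single (F.shift i j) (1 : ℤ)

open Classical in
/-- The K-polynomial `𝒦(A/I; t)`, computed from a finite graded free resolution of `A/I`. Every
homogeneous `I` has one, by Hilbert's syzygy theorem, so that the value `0` in the other case is
not used for such `I`; and the result does not depend on the resolution. -/
def kPolynomial (w : σ → (τ → ℤ)) (I : Ideal (MvPolynomial σ k)) :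
    AddMonoidAlgebra ℤ (τ → ℤ) :=
  if h : Nonempty (GradedFreeResolution w I) then h.some.kPoly else 0

/-- `1 - t_i` as a unit of the power series ring `ℤ⟦t⟧`. -/
def oneSubVar (i : τ) : (MvPowerSeries τ ℤ)ˣ :=
  IsUnit.unit (a := (1 - MvPowerSeries.X i : MvPowerSeries τ ℤ))
    (MvPowerSeries.isUnit_iff_constantCoeff.2 (by simp))

/-- The Laurent monomial `t^b`, evaluated at `1 - t`: the power series `∏_i (1 - t_i)^(b_i)`. -/
def laurentMonomialOneSub : Multiplicative (τ → ℤ) →* MvPowerSeries τ ℤ where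
  toFun b := ((∏ i, oneSubVar i ^ (b.toAdd i) : (MvPowerSeries τ ℤ)ˣ) : MvPowerSeries τ ℤ)
  map_one' := by simp
  map_mul' a b := by simp [zpow_add, Finset.prod_mul_distrib]

/-- The substitution `K(t) ↦ K(1 - t)`, from Laurent polynomials to formal power series. -/
def substOneSub : AddMonoidAlgebra ℤ (τ → ℤ) →ₐ[ℤ] MvPowerSeries τ ℤ :=
  AddMonoidAlgebra.lift ℤ (MvPowerSeries τ ℤ) (τ → ℤ) laurentMonomialOneSub

/-- The codimension `codim (A/I) = n - dim (A/I)`, where `n` is the number of variables of `A` and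
`dim` is the Krull dimension (the zero ring is given dimension `0` here; its K-polynomial is `0`,
so this choice has no effect on its multidegree). -/
def codim (I : Ideal (MvPolynomial σ k)) : ℕ :=
  Fintype.card σ - ((ringKrullDim (MvPolynomial σ k ⧸ I)).unbotD 0).toNat

/-- The multidegree polynomial `𝒞(A/I; t) ∈ ℤ[t]`: the sum of all terms of total degree
`codim (A/I)` in `𝒦(A/I; 1 - t)`. -/
def multidegree (w : σ → (τ → ℤ)) (I : Ideal (MvPolynomial σ k)) : MvPolynomial τ ℤ :=
  homogeneousComponent (codim I)
    (MvPowerSeries.truncTotal (codim I + 1) (substOneSub (kPolynomial w I)))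

/-- The grading `deg x_{ij} = e_i ⊕ (-e_j)` of `k[x_{ij} | 1 ≤ i, j ≤ p]` by `ℤ^p ⊕ ℤ^p`. -/
def degNeg (p : ℕ) (a : Fin p × Fin p) : Fin p ⊕ Fin p → ℤ :=
  Sum.elim (Pi.single a.1 1) (-Pi.single a.2 1)

/-- The grading `deg x_{ij} = e_i ⊕ e_j` of `k[x_{ij} | 1 ≤ i, j ≤ p]` by `ℤ^p ⊕ ℤ^p`. -/
def degPos (p : ℕ) (a : Fin p × Fin p) : Fin p ⊕ Fin p → ℤ :=
  Sum.elim (Pi.single a.1 1) (Pi.single a.2 1)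

/-- The substitution `P(t, s) ↦ P(t, -s)` in `ℤ[t_1, …, t_p, s_1, …, s_p]`; the variable `t_i` is
`X (Sum.inl i)` and the variable `s_i` is `X (Sum.inr i)`. -/
def negS (p : ℕ) : MvPolynomial (Fin p ⊕ Fin p) ℤ →ₐ[ℤ] MvPolynomial (Fin p ⊕ Fin p) ℤ :=
  aeval (Sum.elim (fun i => X (Sum.inl i)) (fun i => -X (Sum.inr i)))

end Multidegree

end

/-! The two gradings differ by the automorphism of `ℤ^p ⊕ ℤ^p` that negates the second summand.
Relabelling degrees turns a graded free resolution for one grading into one for the other, so the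
K-polynomials correspond under `s_j ↦ s_j⁻¹`. Since `1 - (1 - s)⁻¹ = -s (1 - s)⁻¹` is `-s` up to
higher order, the lowest-degree parts of the expansions at `1 - t, 1 - s` correspond under `s ↦ -s`
(`coeff_substOneSub_laurentFlip`).

Two facts about the positive grading complete the argument. The K-polynomial must not depend on the
resolution (`GradedFreeResolution.kPoly_eq`), and its expansion must have no terms of degree below
the codimension (`GradedFreeResolution.coeff_eq_zero_of_degree_lt_codim`), since such terms would
contribute to the degree compared. Both come from the Hilbert series of `A/I`, which converges on
the open unit cube to `𝒦 / ∏ (1 - t^(w a))`. It determines `𝒦`. By Noether normalization its pole at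
`t = 1` has order at most `dim (A/I)`, while the denominator vanishes there to order the number of
variables; hence `𝒦` vanishes to order at least the codimension. -/

open scoped BigOperators

noncomputable section

/-! ### Laurent polynomials, the substitution `t ↦ 1 - t`, and lowest-degree parts -/

namespace Multidegree

open MvPolynomial

variable {τ : Type*} [Fintype τ]

/-- The monoid homomorphism from Laurent monomials given by a family of units. -/
def laurentHom {B : Type*} [CommRing B] (u : τ → Bˣ) : Multiplicative (τ → ℤ) →* B where
  toFun b := ((∏ i, u i ^ (b.toAdd i) : Bˣ) : B)
  map_one' := by simp
  map_mul' a b := by simp [zpow_add, Finset.prod_mul_distrib]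

/-- Evaluation of Laurent polynomials at a family of units. -/
def laurentEval {B : Type*} [CommRing B] (u : τ → Bˣ) : AddMonoidAlgebra ℤ (τ → ℤ) →+* B :=
  (AddMonoidAlgebra.lift ℤ B (τ → ℤ) (laurentHom u)).toRingHom

theorem laurentEval_single {B : Type*} [CommRing B] (u : τ → Bˣ) (b : τ → ℤ) (n : ℤ) :
    laurentEval u (AddMonoidAlgebra.single b n) = n • ((∏ i, u i ^ b i : Bˣ) : B) := by
  simp [laurentEval, laurentHom]

theorem laurentEval_single_single [DecidableEq τ] {B : Type*} [CommRing B] (u : τ → Bˣ) (i : τ) :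
    laurentEval u (AddMonoidAlgebra.single (Pi.single i 1) 1) = u i := by
  rw [laurentEval_single, one_smul, Finset.prod_eq_single i]
  · simp
  · intro j _ hj
    simp [hj]
  · simp

theorem substOneSub_apply (K : AddMonoidAlgebra ℤ (τ → ℤ)) :
    substOneSub K = laurentEval oneSubVar K := by
  induction K using AddMonoidAlgebra.induction_linear with
  | zero => simp
  | add K L hK hL => rw [map_add, map_add, hK, hL]
  | single a n =>
    rw [laurentEval_single, substOneSub, AddMonoidAlgebra.lift_single]
    rw [Algebra.smul_def, eq_intCast, zsmul_eq_mul]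
    rfl

variable [DecidableEq τ]

/-- The substitution `Q(t) ↦ Q(1 - t)` from polynomials to Laurent polynomials. -/
def polyOneSub : MvPolynomial τ ℤ →+* AddMonoidAlgebra ℤ (τ → ℤ) :=
  eval₂Hom (Int.castRingHom _) fun i => 1 - AddMonoidAlgebra.single (Pi.single i 1) 1

theorem laurentEval_polyOneSub {B : Type*} [CommRing B] (u : τ → Bˣ) (Q : MvPolynomial τ ℤ) :
    laurentEval u (polyOneSub Q) = eval₂Hom (Int.castRingHom B) (fun i => 1 - (u i : B)) Q := by
  rw [← RingHom.comp_apply]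
  congr 1
  ext i
  · simp
  · simp [polyOneSub, laurentEval_single_single]

theorem single_mem_range_polyOneSub (a : τ → ℤ) (ha : ∀ i, 0 ≤ a i) :
    AddMonoidAlgebra.single a (1 : ℤ) ∈ (polyOneSub (τ := τ)).range := by
  have h : AddMonoidAlgebra.single a (1 : ℤ) =
      ∏ i, AddMonoidAlgebra.single (Pi.single i (1 : ℤ)) (1 : ℤ) ^ (a i).toNat := by
    simp only [AddMonoidAlgebra.single_pow, one_pow]
    rw [AddMonoidAlgebra.prod_single]
    congr 1
    · ext j
      simp [Finset.sum_apply, Pi.single_apply, ha]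
    · simp
  rw [h]
  refine prod_mem fun i _ => pow_mem (RingHom.mem_range.2 ⟨1 - X i, ?_⟩) _
  simp [polyOneSub]

/-- Every Laurent polynomial is a Laurent monomial times a polynomial in the `1 - t_i`. -/
theorem exists_eq_single_mul_polyOneSub (K : AddMonoidAlgebra ℤ (τ → ℤ)) :
    ∃ (b : τ → ℤ) (Q : MvPolynomial τ ℤ), b ≤ 0 ∧ K = AddMonoidAlgebra.single b 1 * polyOneSub Q := by
  -- Being cleared of denominators by some `t^b` with `b ≥ 0` is stable under sums: the exponents
  -- for the two summands are added.
  suffices h : ∃ b : τ → ℤ, (∀ i, 0 ≤ b i) ∧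
      AddMonoidAlgebra.single b 1 * K ∈ (polyOneSub (τ := τ)).range by
    obtain ⟨b, hb, Q, hQ⟩ := h
    refine ⟨-b, Q, neg_nonpos.2 hb, ?_⟩
    change polyOneSub Q = _ at hQ
    rw [hQ, ← mul_assoc, AddMonoidAlgebra.single_mul_single, neg_add_cancel, one_mul,
      ← AddMonoidAlgebra.one_def, one_mul]
  induction K using AddMonoidAlgebra.induction_linear with
  | zero => exact ⟨0, by simp, by simp⟩
  | add K L hK hL =>
    obtain ⟨b, hb, hbK⟩ := hK
    obtain ⟨c, hc, hcL⟩ := hL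
    refine ⟨b + c, fun i => add_nonneg (hb i) (hc i), ?_⟩
    have h : AddMonoidAlgebra.single (b + c) 1 * (K + L) =
        AddMonoidAlgebra.single c 1 * (AddMonoidAlgebra.single b 1 * K) +
        AddMonoidAlgebra.single b 1 * (AddMonoidAlgebra.single c (1 : ℤ) * L) := by
      rw [← mul_assoc, ← mul_assoc, AddMonoidAlgebra.single_mul_single,
        AddMonoidAlgebra.single_mul_single, mul_add, add_comm c b, one_mul]
    rw [h]
    exact add_mem (mul_mem (single_mem_range_polyOneSub c hc) hbK)
      (mul_mem (single_mem_range_polyOneSub b hb) hcL)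
  | single a n =>
    refine ⟨fun i => |a i|, fun i => abs_nonneg _, ?_⟩
    have h : AddMonoidAlgebra.single (fun i => |a i|) (1 : ℤ) * AddMonoidAlgebra.single a n =
        n • AddMonoidAlgebra.single ((fun i => |a i|) + a) 1 := by
      simp [AddMonoidAlgebra.single_mul_single]
    rw [h]
    refine zsmul_mem (single_mem_range_polyOneSub _ fun i => ?_) _
    have := neg_abs_le (a i)
    simp only [Pi.add_apply]
    linarith

/-- The monomial `X^α` factors out, and a `β` of degree at most that of `α` is divisible by it only
if `β = α`; then only the constant term of the cofactor matters. -/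
theorem coeff_mul_prod_X_mul_pow {ι : Type*} [DecidableEq ι]
    {W : MvPowerSeries ι ℤ} (hW : MvPowerSeries.constantCoeff W = 1)
    {V : ι → MvPowerSeries ι ℤ} {α β : ι →₀ ℕ} (h : β.degree ≤ α.degree) :
    MvPowerSeries.coeff β (W * α.prod fun i n => (MvPowerSeries.X i * V i) ^ n) =
      if α = β then α.prod fun i n => MvPowerSeries.constantCoeff (V i) ^ n else 0 := by
  classical
  have e : W * α.prod (fun i n => (MvPowerSeries.X i * V i) ^ n) =
      MvPowerSeries.monomial α 1 * (W * α.prod fun i n => V i ^ n) := by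
    simp only [mul_pow, Finsupp.prod_mul]
    rw [MvPowerSeries.monomial_one_eq]
    ring
  rw [e, MvPowerSeries.coeff_monomial_mul, one_mul]
  by_cases hαβ : α = β
  · subst hαβ
    simp [hW, Finsupp.prod]
  · rw [if_neg hαβ, if_neg]
    intro hle
    apply hαβ
    obtain ⟨γ, rfl⟩ := exists_add_of_le hle
    have : γ.degree = 0 := by
      rw [map_add] at h
      omega
    rw [(Finsupp.degree_eq_zero_iff γ).1 this, add_zero]

/-- The lowest-degree part of `W * Q(X_i V_i)` depends only on that of `Q` and on the constant
coefficients of the `V_i`. -/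
theorem coeff_mul_aeval_of_order_le {ι : Type*} [Fintype ι]
    {W : MvPowerSeries ι ℤ}
    (hW : MvPowerSeries.constantCoeff W = 1) {V : ι → MvPowerSeries ι ℤ} {Q : MvPolynomial ι ℤ}
    {c : ℕ} (hQ : ∀ α : ι →₀ ℕ, α.degree < c → Q.coeff α = 0) {β : ι →₀ ℕ} (hβ : β.degree = c) :
    MvPowerSeries.coeff β (W *
      eval₂Hom (Int.castRingHom _) (fun i => MvPowerSeries.X i * V i) Q) =
      Q.coeff β * β.prod fun i n => MvPowerSeries.constantCoeff (V i) ^ n := by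
  classical
  rw [coe_eval₂Hom, eval₂_eq', Finset.mul_sum, map_sum]
  have h : ∀ α ∈ Q.support, MvPowerSeries.coeff β (W * (Int.castRingHom (MvPowerSeries ι ℤ)
      (Q.coeff α) * ∏ i, (MvPowerSeries.X i * V i) ^ α i)) =
      if α = β then Q.coeff β * β.prod (fun i n => MvPowerSeries.constantCoeff (V i) ^ n)
        else 0 := by
    intro α hα
    have hc : c ≤ α.degree := by
      by_contra hlt
      exact (mem_support_iff.1 hα) (hQ α (not_le.1 hlt))
    have := coeff_mul_prod_X_mul_pow hW (V := V) (hβ.trans_le hc)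
    rw [Finsupp.prod_fintype _ _ (by simp)] at this
    rw [mul_left_comm, eq_intCast, ← zsmul_eq_mul, map_zsmul, this]
    split_ifs with e
    · subst e; simp
    · simp
  rw [Finset.sum_congr rfl h, Finset.sum_ite_eq']
  split_ifs with hs
  · rfl
  · rw [notMem_support_iff.1 hs, zero_mul]

end Multidegree

/-! ### Sign changes of the degrees and their effect on lowest-degree parts -/

namespace Multidegree

open MvPolynomial

variable {τ : Type*}

/-- The automorphism of `ℤ^τ` that multiplies the `i`-th coordinate by the sign `ε i`. -/
def signFlip (ε : τ → ℤˣ) : (τ → ℤ) →+ (τ → ℤ) where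
  toFun a i := ε i * a i
  map_zero' := by ext; simp
  map_add' a b := by ext; simp [mul_add]

theorem signFlip_apply (ε : τ → ℤˣ) (a : τ → ℤ) (i : τ) : signFlip ε a i = ε i * a i := rfl

theorem signFlip_signFlip (ε : τ → ℤˣ) (a : τ → ℤ) : signFlip ε (signFlip ε a) = a := by
  ext i
  rw [signFlip_apply, signFlip_apply, ← mul_assoc, ← Units.val_mul, Int.units_mul_self,
    Units.val_one, one_mul]

/-- The automorphism `t_i ↦ t_i^(ε i)` of the ring of Laurent polynomials. -/
def laurentFlip (ε : τ → ℤˣ) : AddMonoidAlgebra ℤ (τ → ℤ) →+* AddMonoidAlgebra ℤ (τ → ℤ) :=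
  AddMonoidAlgebra.mapDomainRingHom ℤ (signFlip ε)

theorem laurentFlip_single (ε : τ → ℤˣ) (a : τ → ℤ) (n : ℤ) :
    laurentFlip ε (AddMonoidAlgebra.single a n) = AddMonoidAlgebra.single (signFlip ε a) n := by
  simp [laurentFlip]

theorem laurentFlip_laurentFlip (ε : τ → ℤˣ) (K : AddMonoidAlgebra ℤ (τ → ℤ)) :
    laurentFlip ε (laurentFlip ε K) = K := by
  induction K using AddMonoidAlgebra.induction_linear with
  | zero => simp
  | add K L hK hL => simp only [map_add, hK, hL]
  | single a n => simp only [laurentFlip_single, signFlip_signFlip]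

theorem laurentEval_laurentFlip [Fintype τ] {B : Type*} [CommRing B] (u : τ → Bˣ) (ε : τ → ℤˣ)
    (K : AddMonoidAlgebra ℤ (τ → ℤ)) :
    laurentEval u (laurentFlip ε K) = laurentEval (fun i => u i ^ (ε i : ℤ)) K := by
  induction K using AddMonoidAlgebra.induction_linear with
  | zero => simp
  | add K L hK hL => simp only [map_add, hK, hL]
  | single a n => simp only [laurentFlip_single, laurentEval_single, signFlip_apply, zpow_mul]

theorem constantCoeff_units_zpow {R : Type*} [CommRing R] (u : (MvPowerSeries τ R)ˣ)
    (hu : MvPowerSeries.constantCoeff (u : MvPowerSeries τ R) = 1) (n : ℤ) :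
    MvPowerSeries.constantCoeff ((u ^ n : (MvPowerSeries τ R)ˣ) : MvPowerSeries τ R) = 1 := by
  have h : Units.map (MvPowerSeries.constantCoeff (σ := τ) (R := R)).toMonoidHom u = 1 :=
    Units.ext hu
  have h' : Units.map (MvPowerSeries.constantCoeff (σ := τ) (R := R)).toMonoidHom (u ^ n) = 1 := by
    rw [map_zpow, h, one_zpow]
  exact congrArg Units.val h'

theorem coe_oneSubVar (i : τ) : (oneSubVar i : MvPowerSeries τ ℤ) = 1 - MvPowerSeries.X i :=
  IsUnit.unit_spec _

theorem constantCoeff_oneSubVar (i : τ) :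
    MvPowerSeries.constantCoeff (oneSubVar i : MvPowerSeries τ ℤ) = 1 := by
  simp [coe_oneSubVar]

/-- The source of the signs: for `ε = -1`, `1 - (1 - t)⁻¹ = t · (-(1 - t)⁻¹)`, and the cofactor has
constant term `-1`. -/
theorem one_sub_oneSubVar_zpow (ε : ℤˣ) (i : τ) : ∃ V : MvPowerSeries τ ℤ,
    MvPowerSeries.constantCoeff V = ε ∧
      1 - ((oneSubVar i ^ (ε : ℤ) : (MvPowerSeries τ ℤ)ˣ) : MvPowerSeries τ ℤ) =
        MvPowerSeries.X i * V := by
  rcases Int.units_eq_one_or ε with rfl | rfl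
  · exact ⟨1, by simp, by simp [coe_oneSubVar]⟩
  · refine ⟨-((oneSubVar i ^ (-1 : ℤ) : (MvPowerSeries τ ℤ)ˣ) : MvPowerSeries τ ℤ), ?_, ?_⟩
    · rw [map_neg, constantCoeff_units_zpow _ (constantCoeff_oneSubVar i)]
      simp
    · have h : ((oneSubVar i ^ (-1 : ℤ) : (MvPowerSeries τ ℤ)ˣ) : MvPowerSeries τ ℤ) *
          (1 - MvPowerSeries.X i) = 1 := by
        rw [← coe_oneSubVar, zpow_neg_one, Units.inv_mul]
      simp only [Units.val_neg, Units.val_one]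
      linear_combination -h

/-- If `K = t^b Q(1 - t)` and `Q` has no terms of degree less than `c`, then the part of degree `c`
of `K(t_i^(ε i))`, evaluated at `1 - t`, is that of `Q(ε i t_i)`. -/
theorem coeff_substOneSub_laurentFlip [Fintype τ] [DecidableEq τ] (ε : τ → ℤˣ) (b : τ → ℤ)
    {Q : MvPolynomial τ ℤ} {c : ℕ} (hQ : ∀ α : τ →₀ ℕ, α.degree < c → Q.coeff α = 0)
    {β : τ →₀ ℕ} (hβ : β.degree = c) :
    MvPowerSeries.coeff β (substOneSub (laurentFlip ε
      (AddMonoidAlgebra.single b 1 * polyOneSub Q))) =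
      Q.coeff β * β.prod fun i n => (ε i : ℤ) ^ n := by
  choose V hV1 hV2 using fun i : τ => one_sub_oneSubVar_zpow (ε i) i
  rw [substOneSub_apply, laurentEval_laurentFlip, map_mul, laurentEval_polyOneSub,
    laurentEval_single, one_smul]
  simp only [hV2]
  rw [coeff_mul_aeval_of_order_le _ hQ hβ]
  · simp only [hV1]
  · rw [Units.coe_prod, map_prod]
    refine Finset.prod_eq_one fun i _ => ?_
    rw [← zpow_mul, constantCoeff_units_zpow _ (constantCoeff_oneSubVar i)]

/-- With this, `coeff_substOneSub_laurentFlip` at `ε = 1` also gives the coefficients before the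
sign change. -/
theorem laurentFlip_one (K : AddMonoidAlgebra ℤ (τ → ℤ)) : laurentFlip 1 K = K := by
  induction K using AddMonoidAlgebra.induction_linear with
  | zero => simp
  | add K L hK hL => simp only [map_add, hK, hL]
  | single a n =>
    rw [laurentFlip_single]
    congr 1
    ext i
    simp [signFlip_apply]

/-- The signs of the variables under `P(t, s) ↦ P(t, -s)`. -/
def sumSign (p : ℕ) : Fin p ⊕ Fin p → ℤˣ := Sum.elim 1 (-1)

theorem coeff_negS (p : ℕ) (P : MvPolynomial (Fin p ⊕ Fin p) ℤ) (β : Fin p ⊕ Fin p →₀ ℕ) :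
    (negS p P).coeff β = P.coeff β * β.prod fun i n => (sumSign p i : ℤ) ^ n := by
  induction P using MvPolynomial.induction_on' with
  | add P P' h h' => rw [map_add, coeff_add, coeff_add, h, h', add_mul]
  | monomial α r =>
    have h : negS p (monomial α r) = monomial α (r * α.prod fun i n => (sumSign p i : ℤ) ^ n) := by
      have e : (Sum.elim (fun i => X (Sum.inl i)) fun i => -X (Sum.inr i) :
          Fin p ⊕ Fin p → MvPolynomial (Fin p ⊕ Fin p) ℤ) =
          fun i => C (sumSign p i : ℤ) * X i := by
        ext1 i
        cases i <;> simp [sumSign]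
      rw [negS, aeval_monomial, e, monomial_eq, C_mul]
      simp only [mul_pow, Finsupp.prod_mul]
      simp only [Finsupp.prod, map_prod, map_pow, mul_assoc]
      rfl
    rw [h, coeff_monomial, coeff_monomial]
    split_ifs with hαβ
    · rw [hαβ]
    · simp

end Multidegree

/-! ### The Hilbert function from a graded free resolution -/

namespace Multidegree

open MvPolynomial

section LinearAlgebra

variable {k : Type*} [Field k]

/-- A product of submodules, as a submodule of the product of the ambient modules. -/
def piSubmoduleEquiv {ι : Type*} {M : ι → Type*} [∀ i, AddCommGroup (M i)] [∀ i, Module k (M i)]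
    (p : ∀ i, Submodule k (M i)) : Submodule.pi Set.univ p ≃ₗ[k] ∀ i, p i where
  toFun v i := ⟨v.1 i, v.2 i trivial⟩
  invFun v := ⟨fun i => (v i).1, fun i _ => (v i).2⟩
  map_add' _ _ := rfl
  map_smul' _ _ := rfl
  left_inv _ := rfl
  right_inv _ := rfl

theorem finrank_map_add_finrank_inf_ker {M N : Type*} [AddCommGroup M] [Module k M]
    [AddCommGroup N] [Module k N] (f : M →ₗ[k] N) (p : Submodule k M) [FiniteDimensional k p] :
    Module.finrank k (p.map f) + Module.finrank k (p ⊓ LinearMap.ker f : Submodule k M) =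
      Module.finrank k p := by
  rw [← LinearMap.finrank_range_add_finrank_ker (f.domRestrict p), LinearMap.range_domRestrict,
    LinearMap.ker_domRestrict, ← Submodule.finrank_map_subtype_eq p, Submodule.map_comap_subtype]

end LinearAlgebra

attribute [local instance] MvPolynomial.weightedGradedAlgebra

variable {k σ τ : Type*} [Field k]

section Weighted

variable {M : Type*} [AddCommGroup M] {w : σ → M}

theorem weightedHomogeneousComponent_mul_of_right [DecidableEq M]
    {f g : MvPolynomial σ k} {m n : M}
    (hg : IsWeightedHomogeneous w g n) :
    weightedHomogeneousComponent w (m + n) (f * g) = weightedHomogeneousComponent w m f * g := by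
  rw [← weightedDecomposition.decompose'_apply, ← weightedDecomposition.decompose'_apply]
  exact DirectSum.coe_decompose_mul_add_of_right_mem (weightedHomogeneousSubmodule k w) hg

/-- The homogeneous component of degree `b` of an element of `⨁_j A(-s j)`. -/
def freeComponent {r : ℕ} (w : σ → M) (s : Fin r → M) (b : M) :
    (Fin r → MvPolynomial σ k) →ₗ[k] (Fin r → MvPolynomial σ k) :=
  LinearMap.pi fun l => weightedHomogeneousComponent w (b - s l) ∘ₗ LinearMap.proj l

/-- The graded piece of degree `b` of `⨁_j A(-s j)`. -/
def freePiece {r : ℕ} (k : Type*) [Field k] (w : σ → M) (s : Fin r → M) (b : M) :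
    Submodule k (Fin r → MvPolynomial σ k) :=
  Submodule.pi Set.univ fun l => weightedHomogeneousSubmodule k w (b - s l)

/-- The graded piece of degree `b` of `A/I`. -/
def quotientPiece (w : σ → M) (I : Ideal (MvPolynomial σ k)) (b : M) :
    Submodule k (MvPolynomial σ k ⧸ I) :=
  (weightedHomogeneousSubmodule k w b).map (Ideal.Quotient.mkₐ k I).toLinearMap

theorem freeComponent_apply {r : ℕ} (s : Fin r → M) (b : M) (v : Fin r → MvPolynomial σ k)
    (l : Fin r) :
    freeComponent w s b v l = weightedHomogeneousComponent w (b - s l) (v l) := rfl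

theorem freeComponent_mem {r : ℕ} (s : Fin r → M) (b : M) (v : Fin r → MvPolynomial σ k) :
    freeComponent w s b v ∈ freePiece k w s b :=
  fun l _ => weightedHomogeneousComponent_mem w (v l) (b - s l)

theorem freeComponent_of_mem [DecidableEq M] {r : ℕ} {s : Fin r → M} {b : M}
    {v : Fin r → MvPolynomial σ k} (hv : v ∈ freePiece k w s b) : freeComponent w s b v = v := by
  ext1 l
  rw [freeComponent_apply, weightedHomogeneousComponent_of_mem (hv l trivial), if_pos rfl]

theorem linearMap_pi_apply {R N : Type*} [CommRing R] [AddCommGroup N] [Module R N] {r : ℕ}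
    (f : (Fin r → R) →ₗ[R] N) (v : Fin r → R) : f v = ∑ j, v j • f (Pi.single j 1) := by
  conv_lhs => rw [pi_eq_sum_univ' v]
  rw [map_sum]
  refine Finset.sum_congr rfl fun j _ => ?_
  rw [map_smul]

theorem freeComponent_map [DecidableEq M] {r r' : ℕ} {s : Fin r → M} {s' : Fin r' → M}
    (f : (Fin r' → MvPolynomial σ k) →ₗ[MvPolynomial σ k] (Fin r → MvPolynomial σ k))
    (hf : ∀ j l, IsWeightedHomogeneous w (f (Pi.single j 1) l) (s' j - s l)) (b : M)
    (v : Fin r' → MvPolynomial σ k) :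
    freeComponent w s b (f v) = f (freeComponent w s' b v) := by
  ext1 l
  rw [freeComponent_apply, linearMap_pi_apply f v, linearMap_pi_apply f (freeComponent w s' b v)]
  simp only [Finset.sum_apply, Pi.smul_apply, smul_eq_mul, map_sum, freeComponent_apply]
  refine Finset.sum_congr rfl fun j _ => ?_
  rw [← weightedHomogeneousComponent_mul_of_right (hf j l), sub_add_sub_cancel]

/-- Projection to a graded piece commutes with `f` (`freeComponent_map`), so any preimage of a
homogeneous element may be replaced by its component of degree `b`. -/
theorem exact_freePiece [DecidableEq M] {r r' : ℕ} {N : Type*} [AddCommGroup N]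
    [Module (MvPolynomial σ k) N]
    [Module k N] [IsScalarTower k (MvPolynomial σ k) N] {s : Fin r → M} {s' : Fin r' → M}
    (f : (Fin r' → MvPolynomial σ k) →ₗ[MvPolynomial σ k] (Fin r → MvPolynomial σ k))
    (hf : ∀ j l, IsWeightedHomogeneous w (f (Pi.single j 1) l) (s' j - s l))
    (g : (Fin r → MvPolynomial σ k) →ₗ[MvPolynomial σ k] N) (hfg : Function.Exact f g) (b : M) :
    freePiece k w s b ⊓ LinearMap.ker (g.restrictScalars k) =
      (freePiece k w s' b).map (f.restrictScalars k) := by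
  ext v
  constructor
  · rintro ⟨hv, hgv⟩
    obtain ⟨u, rfl⟩ := (hfg v).1 hgv
    refine ⟨freeComponent w s' b u, freeComponent_mem s' b u, ?_⟩
    rw [LinearMap.restrictScalars_apply, ← freeComponent_map f hf, freeComponent_of_mem hv]
  · rintro ⟨u, hu, rfl⟩
    refine ⟨?_, (hfg _).2 ⟨u, rfl⟩⟩
    rw [LinearMap.restrictScalars_apply, ← freeComponent_of_mem hu, ← freeComponent_map f hf]
    exact freeComponent_mem s b _

variable (w) in
theorem finiteDimensional_freePiece
    [∀ b, FiniteDimensional k (weightedHomogeneousSubmodule k w b)] {r : ℕ} (s : Fin r → M)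
    (b : M) : FiniteDimensional k (freePiece k w s b) :=
  LinearEquiv.finiteDimensional (piSubmoduleEquiv _).symm

variable (w) in
theorem finrank_freePiece
    [∀ b, FiniteDimensional k (weightedHomogeneousSubmodule k w b)] {r : ℕ} (s : Fin r → M)
    (b : M) : Module.finrank k (freePiece k w s b) =
      ∑ j, Module.finrank k (weightedHomogeneousSubmodule k w (b - s j)) := by
  rw [freePiece, (piSubmoduleEquiv _).finrank_eq, Module.finrank_pi_fintype]

end Weighted

variable [Fintype τ] {w : σ → τ → ℤ} {I : Ideal (MvPolynomial σ k)}

theorem GradedFreeResolution.map_aug_freePiece (F : GradedFreeResolution w I)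
    (hI : IsGradedIdeal w I) (b : τ → ℤ) :
    (freePiece k w (F.shift 0) b).map (F.aug.restrictScalars k) = quotientPiece w I b := by
  choose f hf hfa using F.aug_homogeneous
  have haug : ∀ v, F.aug v = Ideal.Quotient.mk I (∑ j, v j * f j) := by
    intro v
    rw [linearMap_pi_apply F.aug, map_sum]
    refine Finset.sum_congr rfl fun j _ => ?_
    rw [hfa, map_mul]
    rfl
  have hcomp : ∀ v : Fin (F.rank 0) → MvPolynomial σ k,
      weightedHomogeneousComponent w b (∑ j, v j * f j) =
        ∑ j, freeComponent w (F.shift 0) b v j * f j := by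
    intro v
    rw [map_sum]
    refine Finset.sum_congr rfl fun j _ => ?_
    rw [freeComponent_apply, ← weightedHomogeneousComponent_mul_of_right (hf j), sub_add_cancel]
  ext x
  constructor
  · rintro ⟨v, hv, rfl⟩
    refine ⟨∑ j, v j * f j, ?_, (haug v).symm⟩
    rw [← freeComponent_of_mem hv, ← hcomp]
    exact weightedHomogeneousComponent_mem _ _ _
  · rintro ⟨g, hg, rfl⟩
    obtain ⟨v, hv⟩ := F.aug_surjective (Ideal.Quotient.mk I g)
    refine ⟨freeComponent w (F.shift 0) b v, freeComponent_mem _ _ _, ?_⟩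
    change F.aug _ = Ideal.Quotient.mk I g
    rw [haug, Ideal.Quotient.eq] at hv
    rw [haug, Ideal.Quotient.eq, ← hcomp]
    -- Homogeneity of `I` enters here: `∑ v_j f_j - g` lies in `I`, hence so does its component of
    -- degree `b`.
    have := weightedHomogeneousComponent_mem_of_mem k w hI hv b
    rwa [map_sub, weightedHomogeneousComponent_of_mem hg, if_pos rfl] at this

/-- The Hilbert function of `A/I`, computed from a graded free resolution. -/
theorem GradedFreeResolution.finrank_quotientPiece [DecidableEq τ] (F : GradedFreeResolution w I)
    (hI : IsGradedIdeal w I) [∀ b, FiniteDimensional k (weightedHomogeneousSubmodule k w b)]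
    (b : τ → ℤ) :
    (Module.finrank k (quotientPiece w I b) : ℤ) = ∑ i ∈ Finset.range (F.len + 1), (-1 : ℤ) ^ i *
      ∑ j, (Module.finrank k (weightedHomogeneousSubmodule k w (b - F.shift i j)) : ℤ) := by
  have := fun i => finiteDimensional_freePiece (k := k) w (F.shift i) b
  -- `ρ i` is the dimension of the image of `F_{i+1} → F_i` in degree `b`. By exactness `F_{i+1}`
  -- has dimension `ρ i + ρ (i + 1)` there, so the alternating sum telescopes.
  set ρ : ℕ → ℤ := fun i => Module.finrank k
    ((freePiece k w (F.shift (i + 1)) b).map ((F.d i).restrictScalars k)) with hρ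
  have h0 : (Module.finrank k (freePiece k w (F.shift 0) b) : ℤ) =
      Module.finrank k (quotientPiece w I b) + ρ 0 := by
    rw [← finrank_map_add_finrank_inf_ker (F.aug.restrictScalars k), F.map_aug_freePiece hI,
      exact_freePiece (F.d 0) (F.d_homogeneous 0) F.aug F.exact_zero]
    push_cast
    rfl
  have hs : ∀ i, (Module.finrank k (freePiece k w (F.shift (i + 1)) b) : ℤ) =
      ρ i + ρ (i + 1) := by
    intro i
    rw [← finrank_map_add_finrank_inf_ker ((F.d i).restrictScalars k),
      exact_freePiece (F.d (i + 1)) (F.d_homogeneous (i + 1)) (F.d i) (F.exact_succ i)]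
    push_cast
    rfl
  have hsum : ∀ n, ∑ i ∈ Finset.range (n + 1), (-1 : ℤ) ^ i *
      (Module.finrank k (freePiece k w (F.shift i) b) : ℤ) =
        Module.finrank k (quotientPiece w I b) + (-1) ^ n * ρ n := by
    intro n
    induction n with
    | zero => simp [h0]
    | succ n ih =>
      rw [Finset.sum_range_succ, ih, hs]
      ring
  -- `F_{len+1} = 0` gives `ρ len + ρ (len + 1) = 0`, and both terms are nonnegative.
  have hlast : ρ F.len = 0 := by
    have h := hs F.len
    have : IsEmpty (Fin (F.rank (F.len + 1))) := by
      rw [F.rank_eq_zero _ (Nat.lt_succ_self _)]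
      infer_instance
    rw [finrank_freePiece, Finset.univ_eq_empty, Finset.sum_empty] at h
    have h1 : 0 ≤ ρ F.len := Nat.cast_nonneg _
    have h2 : 0 ≤ ρ (F.len + 1) := Nat.cast_nonneg _
    push_cast at h
    linarith
  have := hsum F.len
  rw [hlast, mul_zero, add_zero] at this
  rw [← this]
  refine Finset.sum_congr rfl fun i _ => ?_
  rw [finrank_freePiece]
  push_cast
  rfl

end Multidegree

/-! ### Growth of `A/I` is bounded by its Krull dimension -/

namespace Multidegree

open MvPolynomial

/-- Lying over lifts the smallest prime of a chain in `R`; going up then lifts the whole chain. -/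
theorem ringKrullDim_le_of_isIntegral {R S : Type*} [CommRing R] [CommRing S] [Algebra R S]
    [Algebra.IsIntegral R S] (hinj : Function.Injective (algebraMap R S)) :
    ringKrullDim R ≤ ringKrullDim S := by
  refine iSup_le fun l => ?_
  obtain ⟨P, -, hP, hlo⟩ := Ideal.exists_ideal_over_prime_of_isIntegral
    (RelSeries.head l).asIdeal (⊥ : Ideal S) (by
      rw [← RingHom.ker_eq_comap_bot, (RingHom.injective_iff_ker_eq_bot _).1 hinj]
      exact bot_le)
  have : P.LiesOver (RelSeries.head l).asIdeal := ⟨hlo.symm⟩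
  obtain ⟨L, hL, -⟩ := Ideal.exists_ltSeries_of_hasGoingUp l P
  rw [← hL]
  exact Order.LTSeries.length_le_krullDim L

variable {k σ : Type*} [Field k]

theorem finrank_restrictTotalDegree_le (s M : ℕ) :
    Module.finrank k (restrictTotalDegree (Fin s) k M) ≤ (M + 1) ^ s := by
  have e : {n : Fin s →₀ ℕ | ∀ i, n i ≤ M} ≃ (Fin s → Fin (M + 1)) :=
    { toFun := fun n i => ⟨n.1 i, Nat.lt_succ_of_le (n.2 i)⟩
      invFun := fun f => ⟨Finsupp.equivFunOnFinite.symm fun i => f i,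
        fun i => Nat.le_of_lt_succ (f i).2⟩
      left_inv := fun n => by ext; rfl
      right_inv := fun f => by ext; rfl }
  have b := (basisRestrictSupport k {n : Fin s →₀ ℕ | ∀ i, n i ≤ M}).reindex e
  have hfin : FiniteDimensional k (restrictSupport k {n : Fin s →₀ ℕ | ∀ i, n i ≤ M}) :=
    Module.Finite.of_basis b
  refine (Submodule.finrank_mono (t := restrictSupport k {n : Fin s →₀ ℕ | ∀ i, n i ≤ M})
    (restrictSupport_mono k fun n hn i => ?_)).trans ?_
  · have hn' : n.sum (fun _ e => e) ≤ M := hn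
    refine le_trans ?_ hn'
    by_cases hi : i ∈ n.support
    · exact Finset.single_le_sum (f := fun i => n i) (fun _ _ => Nat.zero_le _) hi
    · simp [Finsupp.notMem_support_iff.1 hi]
  · rw [Module.finrank_eq_card_basis b]
    simp

/-- Reaching `1` costs `D` steps of the filtration and each further variable costs `D` more. -/
theorem monomial_induction_of_X_mul {R : Type*} [CommRing R] [Algebra k R]
    (π : MvPolynomial σ k →ₐ[k] R) {V : ℕ → Submodule k R} (hV : Monotone V) {D : ℕ}
    (h1 : 1 ∈ V D) (hX : ∀ a M x, x ∈ V M → π (X a) * x ∈ V (M + D)) (N : ℕ) :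
    (restrictTotalDegree σ k N).map π.toLinearMap ≤ V (D * (N + 1)) := by
  have key : ∀ N (m : σ →₀ ℕ), m.degree ≤ N → π (monomial m 1) ∈ V (D * (N + 1)) := by
    intro N
    induction N with
    | zero =>
      intro m hm
      rw [(Finsupp.degree_eq_zero_iff m).1 (Nat.le_zero.1 hm)]
      simpa using h1
    | succ N ih =>
      intro m hm
      by_cases h0 : m = 0
      · subst h0
        have := hV (Nat.le_mul_of_pos_right D (Nat.succ_pos (N + 1))) h1
        simpa using this
      · obtain ⟨a, ha⟩ := Finsupp.ne_iff.1 h0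
        have hm' : m = Finsupp.single a 1 + (m - Finsupp.single a 1) := by
          rw [add_tsub_cancel_of_le]
          exact Finsupp.single_le_iff.2 (Nat.one_le_iff_ne_zero.2 ha)
        rw [hm', map_add, Finsupp.degree_single] at hm
        have h := hX a _ _ (ih (m - Finsupp.single a 1) (by omega))
        rw [← map_mul, X, monomial_mul, one_mul, ← hm'] at h
        rwa [show D * (N + 1 + 1) = D * (N + 1) + D by ring]
  rw [Submodule.map_le_iff_le_comap, restrictTotalDegree, restrictSupport_eq_span,
    Submodule.span_le]
  rintro _ ⟨m, hm, rfl⟩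
  exact key N m hm

theorem exists_finrank_map_restrictTotalDegree_le_of_finite [Finite σ] {R : Type*} [CommRing R]
    [Algebra k R] (π : MvPolynomial σ k →ₐ[k] R) {s : ℕ} (g : MvPolynomial (Fin s) k →ₐ[k] R)
    (hfin : g.Finite) :
    ∃ C : ℕ, ∀ N : ℕ, Module.finrank k ((restrictTotalDegree σ k N).map π.toLinearMap) ≤
      C * (N + 1) ^ s := by
  let _ := g.toRingHom.toAlgebra
  have : Module.Finite (MvPolynomial (Fin s) k) (R) := hfin
  obtain ⟨r, m, hm⟩ := Module.Finite.exists_fin (R := MvPolynomial (Fin s) k)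
    (M := R)
  let Φ : (Fin r → MvPolynomial (Fin s) k) →ₗ[k] R :=
    ∑ i, LinearMap.mulRight k (m i) ∘ₗ g.toLinearMap ∘ₗ LinearMap.proj i
  have hΦ : ∀ c, Φ c = ∑ i, g (c i) * m i := fun c => by simp [Φ]
  have hsurj : ∀ x, ∃ c, Φ c = x := by
    intro x
    have hx : x ∈ Submodule.span (MvPolynomial (Fin s) k) (Set.range m) := hm ▸ trivial
    obtain ⟨c, hc⟩ := (Submodule.mem_span_range_iff_exists_fun _).1 hx
    exact ⟨c, by rw [hΦ, ← hc]; rfl⟩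
  choose e he using hsurj
  have := Fintype.ofFinite σ
  -- `D` bounds the degrees of chosen coefficients of `1` and of every `x_a m_j` in the generators
  -- `m`. With `V M` the combinations having coefficients of degree at most `M`, multiplication by
  -- `x_a` maps `V M` into `V (M + D)`.
  let D : ℕ := (∑ i, (e 1 i).totalDegree) + ∑ a, ∑ j, ∑ l, (e (π (X a) * m j) l).totalDegree
  let V : ℕ → Submodule k (R) := fun M =>
    (Submodule.pi Set.univ fun _ : Fin r => restrictTotalDegree (Fin s) k M).map Φ
  have hV : Monotone V := fun M N hMN => Submodule.map_mono (Submodule.pi_mono fun _ _ =>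
    restrictSupport_mono k fun _ hn => le_trans hn hMN)
  have h1 : 1 ∈ V D := ⟨e 1, fun i _ => (mem_restrictTotalDegree _ _ _).2
    ((Finset.single_le_sum (f := fun i => (e 1 i).totalDegree) (fun _ _ => Nat.zero_le _)
      (Finset.mem_univ i)).trans (Nat.le_add_right _ _)), he 1⟩
  have hD : ∀ a j l, (e (π (X a) * m j) l).totalDegree ≤ D := by
    intro a j l
    refine le_trans ?_ (Nat.le_add_left _ _)
    refine le_trans ?_ (Finset.single_le_sum (f := fun a => ∑ j, ∑ l,
      (e (π (X a) * m j) l).totalDegree) (fun _ _ => Nat.zero_le _) (Finset.mem_univ a))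
    refine le_trans ?_ (Finset.single_le_sum (f := fun j => ∑ l,
      (e (π (X a) * m j) l).totalDegree) (fun _ _ => Nat.zero_le _) (Finset.mem_univ j))
    exact Finset.single_le_sum (f := fun l => (e (π (X a) * m j) l).totalDegree)
      (fun _ _ => Nat.zero_le _) (Finset.mem_univ l)
  have hX : ∀ a M x, x ∈ V M → π (X a) * x ∈ V (M + D) := by
    rintro a M _ ⟨c, hc, rfl⟩
    refine ⟨fun l => ∑ j, c j * e (π (X a) * m j) l, fun l _ => ?_, ?_⟩
    · exact Submodule.sum_mem _ fun j _ => (mem_restrictTotalDegree _ _ _).2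
        ((totalDegree_mul _ _).trans (Nat.add_le_add
          ((mem_restrictTotalDegree _ _ _).1 (hc j trivial)) (hD a j l)))
    · rw [hΦ, hΦ, Finset.mul_sum]
      simp only [map_sum, map_mul, Finset.sum_mul]
      rw [Finset.sum_comm]
      refine Finset.sum_congr rfl fun j _ => ?_
      have hj : π (X a) * m j = ∑ l, g (e (π (X a) * m j) l) * m l := by rw [← hΦ, he]
      rw [mul_left_comm]
      refine Eq.trans ?_ (congrArg (g (c j) * ·) hj).symm
      simp only [Finset.mul_sum, mul_assoc]
  have hfinD : ∀ M, FiniteDimensional k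
      (Submodule.pi Set.univ fun _ : Fin r => restrictTotalDegree (Fin s) k M) := fun M =>
    LinearEquiv.finiteDimensional (piSubmoduleEquiv _).symm
  refine ⟨r * (D + 1) ^ s, fun N => ?_⟩
  calc _ ≤ Module.finrank k (V (D * (N + 1))) :=
        Submodule.finrank_mono (monomial_induction_of_X_mul π hV h1 hX N)
    _ ≤ Module.finrank k
        (Submodule.pi Set.univ fun _ : Fin r => restrictTotalDegree (Fin s) k (D * (N + 1))) :=
        Submodule.finrank_map_le _ _
    _ = r * Module.finrank k (restrictTotalDegree (Fin s) k (D * (N + 1))) := by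
        rw [(piSubmoduleEquiv _).finrank_eq, Module.finrank_pi_fintype]
        simp
    _ ≤ r * ((D + 1) * (N + 1)) ^ s := by
        refine Nat.mul_le_mul_left _ ((finrank_restrictTotalDegree_le s _).trans
          (Nat.pow_le_pow_left ?_ s))
        rw [Nat.add_mul D 1]
        exact Nat.add_le_add_left (by omega) _
    _ = r * (D + 1) ^ s * (N + 1) ^ s := by rw [mul_pow, mul_assoc]

theorem le_ringKrullDim_of_finite {R : Type*} [CommRing R] [Algebra k R] {s : ℕ}
    (g : MvPolynomial (Fin s) k →ₐ[k] R) (hinj : Function.Injective g) (hfin : g.Finite) :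
    (s : WithBot ℕ∞) ≤ ringKrullDim R := by
  let _ := g.toRingHom.toAlgebra
  have : Algebra.IsIntegral (MvPolynomial (Fin s) k) R := ⟨hfin.to_isIntegral⟩
  have h := ringKrullDim_le_of_isIntegral (R := MvPolynomial (Fin s) k) (S := R) hinj
  rwa [MvPolynomial.ringKrullDim_of_isNoetherianRing, ringKrullDim_eq_zero_of_field, zero_add,
    Nat.card_eq_fintype_card, Fintype.card_fin] at h

/-- The dimension of the image of the polynomials of degree at most `N` in `A/I` is
`O(N ^ dim (A/I))`. -/
theorem exists_finrank_map_restrictTotalDegree_le [Finite σ] (I : Ideal (MvPolynomial σ k)) :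
    ∃ C : ℕ, ∀ N : ℕ, Module.finrank k
      ((restrictTotalDegree σ k N).map (Ideal.Quotient.mkₐ k I).toLinearMap) ≤
        C * (N + 1) ^ ((ringKrullDim (MvPolynomial σ k ⧸ I)).unbotD 0).toNat := by
  by_cases hI : I = ⊤
  · subst hI
    refine ⟨0, fun N => ?_⟩
    have : Subsingleton (MvPolynomial σ k ⧸ (⊤ : Ideal (MvPolynomial σ k))) :=
      Ideal.Quotient.subsingleton_iff.2 rfl
    rw [zero_mul, Module.finrank_zero_of_subsingleton]
  have : Nontrivial (MvPolynomial σ k ⧸ I) := Ideal.Quotient.nontrivial_iff.2 hI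
  obtain ⟨s, g, hinj, hfin⟩ := exists_finite_inj_algHom_of_fg k (MvPolynomial σ k ⧸ I)
  have hdim : s ≤ ((ringKrullDim (MvPolynomial σ k ⧸ I)).unbotD 0).toNat := by
    have h1 := le_ringKrullDim_of_finite g hinj hfin
    -- This makes the dimension finite; `toNat` would send `⊤` to `0`.
    have h2 : ringKrullDim (MvPolynomial σ k ⧸ I) ≤ (Nat.card σ : WithBot ℕ∞) := by
      refine (ringKrullDim_quotient_le I).trans ?_
      rw [MvPolynomial.ringKrullDim_of_isNoetherianRing, ringKrullDim_eq_zero_of_field, zero_add]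
    generalize ringKrullDim (MvPolynomial σ k ⧸ I) = D at h1 h2
    induction D using WithBot.recBotCoe with
    | bot => exact absurd h1 (by simp)
    | coe D =>
      have h2' : D ≤ (Nat.card σ : ℕ∞) := WithBot.coe_le_coe.1 h2
      have h1' : (s : ℕ∞) ≤ D := WithBot.coe_le_coe.1 h1
      lift D to ℕ using ne_top_of_le_ne_top (ENat.natCast_ne_top _) h2'
      simpa using h1'
  obtain ⟨C, hC⟩ := exists_finrank_map_restrictTotalDegree_le_of_finite
    (Ideal.Quotient.mkₐ k I) g hfin
  exact ⟨C, fun N => (hC N).trans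
    (Nat.mul_le_mul_left _ (Nat.pow_le_pow_right (Nat.succ_pos N) hdim))⟩

end Multidegree

/-! ### Hilbert series for positive gradings, as convergent real series -/

namespace Multidegree

open MvPolynomial

section MultiGeometric

theorem hasSum_of_forall_eq {ι : Type*} {f g : ι → ℝ} {a : ℝ} (h : HasSum f a)
    (e : ∀ i, f i = g i) : HasSum g a :=
  funext e ▸ h

theorem hasSum_pi_prod_pow {σ : Type*} [Fintype σ] (x : σ → ℝ) (h0 : ∀ a, 0 ≤ x a)
    (h1 : ∀ a, x a < 1) :
    HasSum (fun m : σ → ℕ => ∏ a, x a ^ m a) (∏ a, (1 - x a)⁻¹) := by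
  refine Fintype.induction_empty_option (P := fun σ _ => ∀ x : σ → ℝ, (∀ a, 0 ≤ x a) →
    (∀ a, x a < 1) → HasSum (fun m : σ → ℕ => ∏ a, x a ^ m a) (∏ a, (1 - x a)⁻¹))
    ?_ ?_ ?_ σ x h0 h1
  · intro α β _ e ih x h0 h1
    let _ := Fintype.ofEquiv β e.symm
    have h := ih (x ∘ e) (fun a => h0 _) (fun a => h1 _)
    rw [← e.prod_comp, ← (Equiv.arrowCongr e (Equiv.refl ℕ)).hasSum_iff]
    refine hasSum_of_forall_eq h fun m => ?_
    rw [Function.comp_apply, ← e.prod_comp]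
    simp
  · intro x _ _
    simp
  · intro α _ ih x h0 h1
    have h := ih (fun a => x (some a)) (fun a => h0 _) (fun a => h1 _)
    have hn := hasSum_geometric_of_lt_one (h0 none) (h1 none)
    rw [Fintype.prod_option, ← Equiv.piOptionEquivProd.symm.hasSum_iff]
    have := hn.mul h (hn.summable.mul_of_nonneg h.summable (fun n => pow_nonneg (h0 none) n)
      (fun m => Finset.prod_nonneg fun a _ => pow_nonneg (h0 _) _))
    refine hasSum_of_forall_eq this fun m => ?_
    rw [Function.comp_apply, Fintype.prod_option]
    simp

end MultiGeometric

variable {τ : Type*}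

theorem weight_nonneg {σ : Type*} {w : σ → τ → ℤ} (hw : ∀ a, 0 < w a) (m : σ →₀ ℕ) :
    0 ≤ Finsupp.weight w m := by
  rw [Finsupp.weight_apply]
  exact Finset.sum_nonneg fun a _ => nsmul_nonneg (hw a).le _

theorem weightedHomogeneousSubmodule_eq_restrictSupport {σ : Type*}
    {w : σ → τ → ℤ} (k : Type*) [Field k] (b : τ → ℤ) :
    weightedHomogeneousSubmodule k w b = restrictSupport k {m | Finsupp.weight w m = b} :=
  weightedHomogeneousSubmodule_eq_finsupp_supported k w b

theorem finrank_weightedHomogeneousSubmodule {σ : Type*} {w : σ → τ → ℤ}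
    (k : Type*) [Field k] (b : τ → ℤ) :
    Module.finrank k (weightedHomogeneousSubmodule k w b) =
      Nat.card {m : σ →₀ ℕ | Finsupp.weight w m = b} := by
  rw [weightedHomogeneousSubmodule_eq_restrictSupport]
  exact Module.finrank_eq_nat_card_basis (basisRestrictSupport k _)

variable [Fintype τ]

/-- The value of the Laurent monomial `t^b` at `u`. -/
def monomialValue (u : τ → ℝˣ) (b : τ → ℤ) : ℝ := ((∏ i, u i ^ b i : ℝˣ) : ℝ)

theorem monomialValue_eq_prod (u : τ → ℝˣ) (b : τ → ℤ) :
    monomialValue u b = ∏ i, (u i : ℝ) ^ b i := by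
  simp [monomialValue]

theorem monomialValue_add (u : τ → ℝˣ) (a b : τ → ℤ) :
    monomialValue u (a + b) = monomialValue u a * monomialValue u b := by
  simp [monomialValue, zpow_add, Finset.prod_mul_distrib]

theorem monomialValue_pos {u : τ → ℝˣ} (hu : ∀ i, 0 < (u i : ℝ)) (b : τ → ℤ) :
    0 < monomialValue u b := by
  rw [monomialValue_eq_prod]
  exact Finset.prod_pos fun i _ => zpow_pos (hu i) _

theorem monomialValue_lt_one {u : τ → ℝˣ} (hu : ∀ i, 0 < (u i : ℝ)) (hu1 : ∀ i, (u i : ℝ) < 1)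
    {b : τ → ℤ} (hb : 0 < b) : monomialValue u b < 1 := by
  obtain ⟨hb0, i, hi⟩ := Pi.lt_def.1 hb
  rw [monomialValue_eq_prod]
  calc _ < ∏ _i : τ, (1 : ℝ) := Finset.prod_lt_prod (fun i _ => zpow_pos (hu i) _)
        (fun i _ => zpow_le_one₀ (hu i) (hu1 i).le (hb0 i))
        ⟨i, Finset.mem_univ i, zpow_lt_one₀ (hu i) (hu1 i) hi⟩
    _ = 1 := by simp

theorem monomialValue_weight {σ : Type*} [Fintype σ] (w : σ → τ → ℤ) (u : τ → ℝˣ) (m : σ →₀ ℕ) :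
    monomialValue u (Finsupp.weight w m) = ∏ a, monomialValue u (w a) ^ m a := by
  change laurentHom u (Multiplicative.ofAdd (Finsupp.weight w m)) =
    ∏ a, laurentHom u (Multiplicative.ofAdd (w a)) ^ m a
  rw [Finsupp.weight_apply, Finsupp.sum_fintype _ _ (by simp), ofAdd_sum, map_prod]
  simp only [ofAdd_nsmul, map_pow]

section PositiveGrading

variable {σ : Type*} [Fintype σ] {w : σ → τ → ℤ}

/-- A positive integer vector has coordinate sum at least `1`. This gives finiteness of the graded
pieces and compares the multigrading with the total degree. -/
theorem degree_le_sum_weight (hw : ∀ a, 0 < w a) (m : σ →₀ ℕ) :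
    (m.degree : ℤ) ≤ ∑ i, Finsupp.weight w m i := by
  have h1 : ∀ a, 1 ≤ ∑ i, w a i := by
    intro a
    obtain ⟨h0, i, hi⟩ := Pi.lt_def.1 (hw a)
    exact Finset.sum_pos' (fun i _ => h0 i) ⟨i, Finset.mem_univ i, hi⟩
  rw [Finsupp.weight_apply, Finsupp.sum_fintype _ _ (by simp), Finsupp.degree_eq_sum]
  simp only [Finset.sum_apply, Pi.smul_apply]
  rw [Finset.sum_comm, Nat.cast_sum]
  refine Finset.sum_le_sum fun a _ => ?_
  rw [← Finset.smul_sum, nsmul_eq_mul]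
  exact le_mul_of_one_le_right (Nat.cast_nonneg _) (h1 a)

theorem finite_weight_eq (hw : ∀ a, 0 < w a) (b : τ → ℤ) :
    {m : σ →₀ ℕ | Finsupp.weight w m = b}.Finite := by
  refine (Finsupp.finite_of_degree_le (∑ i, b i).toNat).subset fun m hm => ?_
  have := degree_le_sum_weight hw m
  rw [Set.mem_ofPred_eq] at hm
  rw [hm] at this
  rw [Set.mem_ofPred_eq]
  omega

theorem finiteDimensional_weightedHomogeneousSubmodule (k : Type*) [Field k]
    (hw : ∀ a, 0 < w a) (b : τ → ℤ) :
    FiniteDimensional k (weightedHomogeneousSubmodule k w b) := by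
  have := (finite_weight_eq hw b).to_subtype
  rw [weightedHomogeneousSubmodule_eq_restrictSupport]
  exact Module.Finite.of_basis (basisRestrictSupport k _)

/-- The Hilbert series of a positively graded polynomial ring. -/
theorem hasSum_finrank_weightedHomogeneousSubmodule (k : Type*) [Field k] (hw : ∀ a, 0 < w a)
    {u : τ → ℝˣ} (hu : ∀ i, 0 < (u i : ℝ)) (hu1 : ∀ i, (u i : ℝ) < 1) :
    HasSum (fun b : τ → ℤ =>
      (Module.finrank k (weightedHomogeneousSubmodule k w b) : ℝ) * monomialValue u b)
      (∏ a, (1 - monomialValue u (w a))⁻¹) := by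
  have h := hasSum_pi_prod_pow (fun a => monomialValue u (w a))
    (fun a => (monomialValue_pos hu _).le) (fun a => monomialValue_lt_one hu hu1 (hw a))
  -- The multiple geometric series is regrouped by the weight of the exponent.
  rw [← (Finsupp.equivFunOnFinite (α := σ) (M := ℕ)).hasSum_iff,
    ← (Equiv.sigmaFiberEquiv (Finsupp.weight w)).hasSum_iff] at h
  refine h.sigma fun b => ?_
  have := (finite_weight_eq hw b).to_subtype
  have := Fintype.ofFinite {m : σ →₀ ℕ | Finsupp.weight w m = b}
  rw [finrank_weightedHomogeneousSubmodule, Nat.card_eq_fintype_card]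
  have hc := hasSum_fintype fun _ : {m : σ →₀ ℕ | Finsupp.weight w m = b} => monomialValue u b
  rw [Finset.sum_const, Finset.card_univ, nsmul_eq_mul] at hc
  refine hasSum_of_forall_eq hc fun m => ?_
  have hm : Finsupp.weight w m.1 = b := m.2
  exact (congrArg (monomialValue u) hm).symm.trans (monomialValue_weight w u m.1)

variable [DecidableEq τ] {k : Type*} [Field k] {I : Ideal (MvPolynomial σ k)}

/-- The Hilbert series of `A/I` is `𝒦(A/I; t) / ∏ (1 - t^(w a))`. -/
theorem GradedFreeResolution.hasSum_finrank_quotientPiece (F : GradedFreeResolution w I)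
    (hI : IsGradedIdeal w I) (hw : ∀ a, 0 < w a) {u : τ → ℝˣ} (hu : ∀ i, 0 < (u i : ℝ))
    (hu1 : ∀ i, (u i : ℝ) < 1) :
    HasSum (fun b : τ → ℤ => (Module.finrank k (quotientPiece w I b) : ℝ) * monomialValue u b)
      (laurentEval u F.kPoly * ∏ a, (1 - monomialValue u (w a))⁻¹) := by
  have := finiteDimensional_weightedHomogeneousSubmodule k hw
  have hs : ∀ s : τ → ℤ, HasSum (fun b : τ → ℤ =>
      (Module.finrank k (weightedHomogeneousSubmodule k w (b - s)) : ℝ) * monomialValue u b)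
      (monomialValue u s * ∏ a, (1 - monomialValue u (w a))⁻¹) := by
    intro s
    have h := (hasSum_finrank_weightedHomogeneousSubmodule k hw hu hu1).mul_left
      (monomialValue u s)
    rw [← (Equiv.subRight s).hasSum_iff] at h
    refine hasSum_of_forall_eq h fun b => ?_
    rw [Function.comp_apply, Equiv.subRight_apply, mul_left_comm, ← monomialValue_add,
      add_sub_cancel]
  have h := hasSum_sum fun i (_ : i ∈ Finset.range (F.len + 1)) =>
    (hasSum_sum fun j (_ : j ∈ Finset.univ) => hs (F.shift i j)).mul_left ((-1 : ℝ) ^ i)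
  have hK : laurentEval u F.kPoly =
      ∑ i ∈ Finset.range (F.len + 1), (-1 : ℝ) ^ i * ∑ j, monomialValue u (F.shift i j) := by
    rw [GradedFreeResolution.kPoly, map_sum]
    refine Finset.sum_congr rfl fun i _ => ?_
    rw [map_zsmul, map_sum, zsmul_eq_mul]
    simp [laurentEval_single, monomialValue]
  rw [hK, Finset.sum_mul]
  simp only [mul_assoc, Finset.sum_mul]
  refine hasSum_of_forall_eq h fun b => ?_
  have hb := congrArg (Int.cast : ℤ → ℝ) (F.finrank_quotientPiece hI b)
  push_cast at hb
  rw [hb, Finset.sum_mul]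
  simp only [mul_assoc, Finset.sum_mul]

end PositiveGrading

end Multidegree

/-! ### Orders of vanishing along rays, and values of Laurent polynomials near `1` -/

namespace Multidegree

open MvPolynomial

/-- Restriction to the line `v ↦ v c` reduces the vanishing of homogeneous components to one
variable. -/
theorem eval_homogeneousComponent_eq_coeff {τ : Type*} (P : MvPolynomial τ ℝ) (c : τ → ℝ) (j : ℕ) :
    eval c (homogeneousComponent j P) =
      (aeval (fun i => Polynomial.C (c i) * Polynomial.X) P).coeff j := by
  induction P using MvPolynomial.induction_on' with
  | add P P' h h' => simp only [map_add, Polynomial.coeff_add, h, h']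
  | monomial α r =>
    have h : aeval (fun i => Polynomial.C (c i) * Polynomial.X) (monomial α r) =
        Polynomial.C (r * α.prod fun i n => c i ^ n) * Polynomial.X ^ α.degree := by
      rw [aeval_monomial]
      simp only [mul_pow, Finsupp.prod_mul]
      simp only [Finsupp.prod, Finset.prod_pow_eq_pow_sum, map_mul, map_prod, map_pow,
        Finsupp.degree_apply]
      rw [Polynomial.algebraMap_apply, Algebra.algebraMap_self_apply, mul_assoc]
    rw [h, Polynomial.coeff_C_mul_X_pow]
    by_cases hj : j = α.degree
    · rw [if_pos hj, homogeneousComponent_of_mem (isHomogeneous_monomial r rfl), if_pos hj,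
        eval_monomial]
    · rw [if_neg hj, homogeneousComponent_of_mem (isHomogeneous_monomial r rfl), if_neg hj, map_zero]

/-- Letting `v → 0⁺` in the bound gives `q(0) = 0`; dividing by `X` lowers the exponent by one. -/
theorem X_pow_dvd_of_abs_eval_le {D δ : ℝ} (hδ : 0 < δ) (c : ℕ) (q : Polynomial ℝ)
    (h : ∀ v, 0 < v → v < δ → |q.eval v| ≤ D * v ^ c) : Polynomial.X ^ c ∣ q := by
  induction c generalizing q with
  | zero => simp
  | succ c ih =>
    have h0 : q.eval 0 = 0 := by
      have h1 : Filter.Tendsto (fun v => q.eval v) (nhdsWithin 0 (Set.Ioi 0)) (nhds (q.eval 0)) :=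
        q.continuous.continuousAt.tendsto.mono_left nhdsWithin_le_nhds
      have h2 : Filter.Tendsto (fun v : ℝ => D * v ^ (c + 1)) (nhdsWithin 0 (Set.Ioi 0))
          (nhds 0) := by
        have : Continuous fun v : ℝ => D * v ^ (c + 1) := by fun_prop
        have := this.continuousAt.tendsto.mono_left
          (nhdsWithin_le_nhds (a := (0 : ℝ)) (s := Set.Ioi 0))
        simpa using this
      refine tendsto_nhds_unique h1 (squeeze_zero_norm' ?_ h2)
      filter_upwards [Ioo_mem_nhdsGT hδ] with v hv
      exact h v hv.1 hv.2
    obtain ⟨r, rfl⟩ : Polynomial.X ∣ q :=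
      Polynomial.X_dvd_iff.2 (by rwa [Polynomial.coeff_zero_eq_eval_zero])
    rw [pow_succ']
    refine mul_dvd_mul_left _ (ih r fun v hv hvδ => ?_)
    have := h v hv hvδ
    rw [Polynomial.eval_mul, Polynomial.eval_X, abs_mul, abs_of_pos hv, pow_succ'] at this
    refine le_of_mul_le_mul_left ?_ hv
    linarith

section Laurent

variable {τ : Type*} [Fintype τ]

theorem monomialValue_le_pow_of_le {u : τ → ℝˣ} (hu : ∀ i, 0 < (u i : ℝ)) {z : ℝ}
    (hz : ∀ i, (u i : ℝ) ≤ z) {b : τ → ℤ} (hb : 0 ≤ b) :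
    monomialValue u b ≤ z ^ (∑ i, b i).toNat := by
  lift b to τ → ℕ using hb
  rw [monomialValue_eq_prod, ← Nat.cast_sum, Int.toNat_natCast, ← Finset.prod_pow_eq_pow_sum]
  refine Finset.prod_le_prod (fun i _ => (zpow_pos (hu i) _).le) fun i _ => ?_
  rw [zpow_natCast]
  exact pow_le_pow_left₀ (hu i).le (hz i) _

/-- Bernoulli's inequality for `(1 - 2v)^(∑ b i)`. The factor `2` bounds the slopes of the rays used
later. -/
theorem one_sub_monomialValue_le {u : τ → ℝˣ} {v : ℝ} (hv0 : 0 < v) (hv : v < 1 / 2)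
    (hu : ∀ i, 1 - 2 * v ≤ (u i : ℝ)) {b : τ → ℤ} (hb : 0 ≤ b) :
    1 - monomialValue u b ≤ (2 * ∑ i, b i) * v := by
  lift b to τ → ℕ using hb
  have h1 : (1 - 2 * v) ^ (∑ i, b i) ≤ monomialValue u (fun i => (b i : ℤ)) := by
    rw [monomialValue_eq_prod, ← Finset.prod_pow_eq_pow_sum]
    refine Finset.prod_le_prod (fun i _ => pow_nonneg (by linarith) _) fun i _ => ?_
    rw [zpow_natCast]
    exact pow_le_pow_left₀ (by linarith) (hu i) _
  have h2 := one_add_mul_le_pow (a := -(2 * v)) (by linarith) (∑ i, b i)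
  rw [← sub_eq_add_neg 1 (2 * v)] at h2
  push_cast at h2 ⊢
  linarith

theorem one_le_monomialValue {u : τ → ℝˣ} (hu : ∀ i, 0 < (u i : ℝ)) (hu1 : ∀ i, (u i : ℝ) < 1)
    {b : τ → ℤ} (hb : b ≤ 0) : 1 ≤ monomialValue u b := by
  rw [monomialValue_eq_prod, ← Finset.prod_const_one (s := (Finset.univ : Finset τ)) (M := ℝ)]
  refine Finset.prod_le_prod (fun _ _ => zero_le_one) fun i _ => ?_
  have := zpow_le_one₀ (hu i) (hu1 i).le (neg_nonneg.2 (hb i))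
  rw [zpow_neg] at this
  exact (inv_le_one₀ (zpow_pos (hu i) _)).1 this

variable [DecidableEq τ]

theorem laurentEval_single_mul_polyOneSub (u : τ → ℝˣ) (b : τ → ℤ) (Q : MvPolynomial τ ℤ) :
    laurentEval u (AddMonoidAlgebra.single b 1 * polyOneSub Q) =
      monomialValue u b * eval (fun i => 1 - (u i : ℝ)) (map (Int.castRingHom ℝ) Q) := by
  rw [map_mul, laurentEval_single, one_smul, laurentEval_polyOneSub, eval_map]
  rfl

/-- A Laurent polynomial is determined by its values on the open unit cube. -/
theorem eq_of_laurentEval_eq {K L : AddMonoidAlgebra ℤ (τ → ℤ)}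
    (h : ∀ u : τ → ℝˣ, (∀ i, 0 < (u i : ℝ)) → (∀ i, (u i : ℝ) < 1) →
      laurentEval u K = laurentEval u L) : K = L := by
  obtain ⟨b, Q, -, hQ⟩ := exists_eq_single_mul_polyOneSub (K - L)
  have hQ0 : map (Int.castRingHom ℝ) Q = 0 := by
    refine funext_set (fun _ => Set.Ioo 0 1) (fun _ => Set.Ioo_infinite one_pos) fun x hx => ?_
    have hx0 : ∀ i, 0 < 1 - x i := fun i => sub_pos.2 (hx i trivial).2
    let u : τ → ℝˣ := fun i => Units.mk0 (1 - x i) (hx0 i).ne'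
    have hu := h u hx0 (fun i => by simpa [u] using (hx i trivial).1)
    rw [← sub_eq_zero, ← map_sub, hQ, laurentEval_single_mul_polyOneSub] at hu
    have := (mul_eq_zero.1 hu).resolve_left (monomialValue_pos hx0 b).ne'
    simpa [u] using this
  rw [← sub_eq_zero, hQ, map_injective _ Int.cast_injective (hQ0.trans (map_zero _).symm),
    map_zero, mul_zero]

end Laurent

end Multidegree

/-! ### The pole of the Hilbert series and the order of vanishing of the K-polynomial -/

namespace Multidegree

open MvPolynomial

/-- A weighted sum whose partial counts grow like `N ^ d` has at most a pole of order `d`. -/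
theorem sum_mul_pow_le_of_growth {ι : Type*} (B : Finset ι) (h : ι → ℝ)
    (deg : ι → ℕ) {C : ℝ} (hC0 : 0 ≤ C) {d : ℕ}
    (hC : ∀ N : ℕ, ∑ b ∈ B with deg b ≤ N, h b ≤ C * (N + 1) ^ d)
    {z : ℝ} (hz0 : 0 < z) (hz1 : z < 1) :
    ∑ b ∈ B, h b * z ^ deg b ≤ C * d.factorial / (1 - z) ^ d := by
  have hz : 0 < 1 - z := sub_pos.2 hz1
  -- Abel summation: the weighted sum divided by `1 - z` is the generating series of the partial
  -- counts, to be compared with `∑ (N + d choose d) z^N = (1 - z)^(-d-1)`.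
  have h1 : ∀ n : ℕ, HasSum (fun N : ℕ => if n ≤ N then z ^ N else 0) (z ^ n * (1 - z)⁻¹) := by
    intro n
    have hg := (hasSum_geometric_of_lt_one hz0.le hz1).mul_left (z ^ n)
    have hinj : Function.Injective fun m : ℕ => n + m := fun a b hab => Nat.add_left_cancel hab
    refine (hinj.hasSum_iff fun N hN => ?_).1 (hasSum_of_forall_eq hg fun m => ?_)
    · rw [if_neg]
      exact fun hle => hN ⟨N - n, Nat.add_sub_cancel' hle⟩
    · simp [pow_add]
  have h2 : HasSum (fun N : ℕ => (∑ b ∈ B with deg b ≤ N, h b) * z ^ N)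
      (∑ b ∈ B, h b * (z ^ deg b * (1 - z)⁻¹)) := by
    refine hasSum_of_forall_eq (hasSum_sum fun b _ => (h1 (deg b)).mul_left (h b)) fun N => ?_
    simp only [mul_ite, mul_zero]
    rw [← Finset.sum_filter, Finset.sum_mul]
  have h3 := (hasSum_choose_mul_geometric_of_norm_lt_one d
    (r := z) (by rwa [Real.norm_of_nonneg hz0.le])).mul_left (C * d.factorial)
  have h4 := hasSum_le (fun N => ?_) h2 h3
  · have e : ∑ b ∈ B, h b * (z ^ deg b * (1 - z)⁻¹) = (∑ b ∈ B, h b * z ^ deg b) * (1 - z)⁻¹ := by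
      rw [Finset.sum_mul]
      exact Finset.sum_congr rfl fun b _ => (mul_assoc _ _ _).symm
    rw [e, ← div_eq_mul_inv, div_le_iff₀ hz] at h4
    refine h4.trans_eq ?_
    rw [pow_succ, mul_assoc, one_div, mul_inv, inv_mul_cancel_right₀ hz.ne', ← div_eq_mul_inv]
  · rw [← mul_assoc]
    refine mul_le_mul_of_nonneg_right ((hC N).trans ?_) (pow_nonneg hz0.le _)
    rw [mul_assoc]
    refine mul_le_mul_of_nonneg_left ?_ hC0
    have := Nat.pow_succ_le_ascFactorial (N + 1) d
    rw [Nat.ascFactorial_eq_factorial_mul_choose] at this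
    exact_mod_cast this

theorem quotientPiece_eq_bot_of_not_nonneg {σ τ k : Type*} [Field k] {w : σ → τ → ℤ}
    {I : Ideal (MvPolynomial σ k)} (hw : ∀ a, 0 < w a) {b : τ → ℤ} (hb : ¬ 0 ≤ b) :
    quotientPiece w I b = ⊥ := by
  rw [quotientPiece, eq_bot_iff, Submodule.map_le_iff_le_comap]
  intro f hf
  have : f = 0 := by
    ext m
    refine IsWeightedHomogeneous.coeff_eq_zero hf m fun hm => hb ?_
    exact hm ▸ weight_nonneg hw m
  rw [this]
  exact Submodule.zero_mem _

section Piece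

variable {σ τ k : Type*} [Field k] [Fintype σ] [Fintype τ] {w : σ → τ → ℤ}
  {I : Ideal (MvPolynomial σ k)}

/-- The pieces are independent in `A/I` because `I` is homogeneous, and all lie in the image of the
polynomials of degree at most `N` by `degree_le_sum_weight`. -/
theorem sum_finrank_quotientPiece_le (hI : IsGradedIdeal w I) (hw : ∀ a, 0 < w a)
    (B : Finset (τ → ℤ)) {N : ℕ} (hB : ∀ b ∈ B, (∑ i, b i).toNat ≤ N) :
    ∑ b ∈ B, Module.finrank k (quotientPiece w I b) ≤ Module.finrank k
      ((restrictTotalDegree σ k N).map (Ideal.Quotient.mkₐ k I).toLinearMap) := by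
  have hle : ∀ b : B, quotientPiece w I b.1 ≤
      (restrictTotalDegree σ k N).map (Ideal.Quotient.mkₐ k I).toLinearMap := by
    intro b
    rw [quotientPiece, weightedHomogeneousSubmodule_eq_restrictSupport]
    refine Submodule.map_mono (restrictSupport_mono k fun m hm => ?_)
    have h1 := degree_le_sum_weight hw m
    rw [Set.mem_ofPred_eq] at hm
    rw [hm] at h1
    have h2 := hB b.1 b.2
    change m.degree ≤ N
    omega
  have := finiteDimensional_weightedHomogeneousSubmodule k hw
  have hfin : ∀ b : B, FiniteDimensional k (quotientPiece w I b.1) := fun b => by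
    unfold quotientPiece
    infer_instance
  let f : (∀ b : B, quotientPiece w I b.1) →ₗ[k]
      (restrictTotalDegree σ k N).map (Ideal.Quotient.mkₐ k I).toLinearMap :=
    ∑ b, Submodule.inclusion (hle b) ∘ₗ LinearMap.proj b
  have hf : Function.Injective f := by
    rw [← LinearMap.ker_eq_bot, LinearMap.ker_eq_bot']
    intro v hv
    choose g hg hgv using fun b : B => (v b).2
    have hsum : Ideal.Quotient.mk I (∑ b, g b) = 0 := by
      have := congrArg Subtype.val hv
      simp only [f, LinearMap.sum_apply, LinearMap.comp_apply, LinearMap.proj_apply,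
        Submodule.coe_sum, Submodule.coe_inclusion, Submodule.coe_zero] at this
      rw [map_sum, ← this]
      exact Finset.sum_congr rfl fun b _ => hgv b
    rw [Ideal.Quotient.eq_zero_iff_mem] at hsum
    ext1 b
    have hb := weightedHomogeneousComponent_mem_of_mem k w hI hsum b.1
    rw [map_sum, Finset.sum_eq_single b, weightedHomogeneousComponent_of_mem (hg b),
      if_pos rfl] at hb
    · exact Subtype.ext ((hgv b).symm.trans (Ideal.Quotient.eq_zero_iff_mem.2 hb))
    · intro c _ hcb
      rw [weightedHomogeneousComponent_of_mem (hg c), if_neg]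
      exact fun h => hcb (Subtype.ext h.symm)
    · simp
  have h := LinearMap.finrank_le_finrank_of_injective hf
  rw [Module.finrank_pi_fintype] at h
  rwa [← Finset.sum_coe_sort]

/-- The Hilbert series of `A/I` has a pole of order at most `dim (A/I)` at `1`. -/
theorem exists_hasSum_finrank_quotientPiece_le (hI : IsGradedIdeal w I) (hw : ∀ a, 0 < w a) :
    ∃ C : ℝ, 0 ≤ C ∧ ∀ (z : ℝ) (u : τ → ℝˣ) (s : ℝ), 0 < z → z < 1 → (∀ i, 0 < (u i : ℝ)) →
      (∀ i, (u i : ℝ) ≤ z) →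
      HasSum (fun b : τ → ℤ => (Module.finrank k (quotientPiece w I b) : ℝ) * monomialValue u b) s →
      s ≤ C / (1 - z) ^ ((ringKrullDim (MvPolynomial σ k ⧸ I)).unbotD 0).toNat := by
  obtain ⟨C, hC⟩ := exists_finrank_map_restrictTotalDegree_le I
  set d := ((ringKrullDim (MvPolynomial σ k ⧸ I)).unbotD 0).toNat
  refine ⟨C * d.factorial, by positivity, fun z u s hz0 hz1 hu huz hs => ?_⟩
  refine hasSum_le_of_sum_le hs fun B => ?_
  refine le_trans (Finset.sum_le_sum fun b _ => ?_) (sum_mul_pow_le_of_growth B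
    (fun b => (Module.finrank k (quotientPiece w I b) : ℝ)) (fun b => (∑ i, b i).toNat)
    (Nat.cast_nonneg C) (fun N => ?_) hz0 hz1)
  · by_cases hb : 0 ≤ b
    · exact mul_le_mul_of_nonneg_left (monomialValue_le_pow_of_le hu huz hb) (Nat.cast_nonneg _)
    · rw [quotientPiece_eq_bot_of_not_nonneg hw hb]
      simp
  · have h := (sum_finrank_quotientPiece_le hI hw (B.filter fun b => (∑ i, b i).toNat ≤ N)
      (N := N) fun b hb => (Finset.mem_filter.1 hb).2).trans (hC N)
    exact_mod_cast h

variable [DecidableEq τ]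

/-- The expansion of `𝒦(A/I; 1 - t)` has no terms of degree less than `codim (A/I)`. -/
theorem GradedFreeResolution.coeff_eq_zero_of_degree_lt_codim (F : GradedFreeResolution w I)
    (hI : IsGradedIdeal w I) (hw : ∀ a, 0 < w a) {b : τ → ℤ} (hb : b ≤ 0) {Q : MvPolynomial τ ℤ}
    (hQ : F.kPoly = AddMonoidAlgebra.single b 1 * polyOneSub Q) {α : τ →₀ ℕ}
    (hα : α.degree < codim I) : Q.coeff α = 0 := by
  obtain ⟨C, hC0, hC⟩ := exists_hasSum_finrank_quotientPiece_le hI hw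
  rw [codim] at hα
  set d := ((ringKrullDim (MvPolynomial σ k ⧸ I)).unbotD 0).toNat
  set P := map (Int.castRingHom ℝ) Q
  let M : ℝ := ∏ a, (2 * ∑ i, w a i : ℝ)
  -- On the ray `u = 1 - v c` with `0 < v < 1/2`, slopes in `(1, 2)` give `0 < u_i ≤ 1 - v` and `u_i
  -- ≥ 1 - 2v`, so `v` controls both the pole and the denominator.
  have key : ∀ c : τ → ℝ, (∀ i, c i ∈ Set.Ioo (1 : ℝ) 2) →
      eval c (homogeneousComponent α.degree P) = 0 := by
    intro c hc
    rw [eval_homogeneousComponent_eq_coeff]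
    refine Polynomial.X_pow_dvd_iff.1 (X_pow_dvd_of_abs_eval_le (D := M * C) (δ := 1 / 2)
      (by norm_num) (Fintype.card σ - d) _ fun v hv0 hv => ?_) _ hα
    have hpos : ∀ i, 0 < 1 - v * c i := fun i => by nlinarith [(hc i).1, (hc i).2]
    have hle : ∀ i, 1 - v * c i ≤ 1 - v := fun i => by nlinarith [(hc i).1, (hc i).2]
    let u : τ → ℝˣ := fun i => Units.mk0 (1 - v * c i) (hpos i).ne'
    have hu1 : ∀ i, (u i : ℝ) < 1 := fun i => (hle i).trans_lt (by linarith)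
    have hsum := F.hasSum_finrank_quotientPiece hI hw (u := u) hpos hu1
    have hbound := hC (1 - v) u _ (by linarith) (by linarith) hpos hle hsum
    have hnonneg : 0 ≤ laurentEval u F.kPoly * ∏ a, (1 - monomialValue u (w a))⁻¹ :=
      hsum.nonneg fun b => mul_nonneg (Nat.cast_nonneg _) (monomialValue_pos hpos b).le
    have hfac : ∀ a, 0 < 1 - monomialValue u (w a) := fun a =>
      sub_pos.2 (monomialValue_lt_one hpos hu1 (hw a))
    have hprod : ∏ a, (1 - monomialValue u (w a)) ≤ M * v ^ Fintype.card σ := by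
      calc _ ≤ ∏ a, ((2 * ∑ i, w a i : ℝ) * v) := Finset.prod_le_prod (fun a _ => (hfac a).le)
            fun a _ => by
              have := one_sub_monomialValue_le hv0 hv (u := u)
                (fun i => by change _ ≤ 1 - v * c i; nlinarith [(hc i).1, (hc i).2]) (hw a).le
              exact_mod_cast this
        _ = _ := by rw [Finset.prod_mul_distrib, Finset.prod_const, Finset.card_univ]
    have heval : (aeval (fun i => Polynomial.C (c i) * Polynomial.X) P).eval v =
        eval (fun i => 1 - (u i : ℝ)) P := by
      have e : (fun i => 1 - (u i : ℝ)) = fun i => v * c i := by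
        ext i
        simp [u]
      have hom : (Polynomial.evalRingHom v).comp
          (aeval fun i => Polynomial.C (c i) * Polynomial.X).toRingHom =
          eval (fun i => v * c i) := by
        ext i
        · simp
        · simp only [RingHom.comp_apply, AlgHom.toRingHom_eq_coe, RingHom.coe_coe, aeval_X, eval_X,
            Polynomial.coe_evalRingHom, Polynomial.eval_mul, Polynomial.eval_C, Polynomial.eval_X]
          exact mul_comm _ _
      rw [e]
      exact RingHom.congr_fun hom P
    have hKQ := laurentEval_single_mul_polyOneSub u b Q
    rw [← hQ] at hKQ
    have hone := one_le_monomialValue hpos hu1 hb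
    have hKval : laurentEval u F.kPoly = (laurentEval u F.kPoly *
        ∏ a, (1 - monomialValue u (w a))⁻¹) * ∏ a, (1 - monomialValue u (w a)) := by
      rw [mul_assoc, ← Finset.prod_mul_distrib, Finset.prod_eq_one, mul_one]
      exact fun a _ => inv_mul_cancel₀ (hfac a).ne'
    have hK0 : 0 ≤ laurentEval u F.kPoly := by
      rw [hKval]
      exact mul_nonneg hnonneg (Finset.prod_nonneg fun a _ => (hfac a).le)
    have hKle : laurentEval u F.kPoly ≤ M * C * v ^ (Fintype.card σ - d) := by
      rw [sub_sub_cancel] at hbound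
      rw [hKval]
      refine (mul_le_mul hbound hprod (Finset.prod_nonneg fun a _ => (hfac a).le)
        (by positivity)).trans_eq ?_
      -- The truncated difference is positive by `hα`, so `d ≤ Fintype.card σ`.
      rw [pow_sub₀ _ hv0.ne' (by omega)]
      field_simp
    rw [heval]
    refine le_trans ?_ hKle
    -- Since `b ≤ 0`, the factor `u^b` is at least `1`, so `0 ≤ P ≤ 𝒦` on the ray.
    rw [hKQ] at hK0 ⊢
    have hP0 : 0 ≤ eval (fun i => 1 - (u i : ℝ)) P :=
      nonneg_of_mul_nonneg_right hK0 (monomialValue_pos hpos b)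
    rw [abs_of_nonneg hP0]
    exact le_mul_of_one_le_left hP0 hone
  have hP : homogeneousComponent α.degree P = 0 :=
    funext_set (fun _ => Set.Ioo 1 2) (fun _ => Set.Ioo_infinite one_lt_two) fun c hc => by
      rw [key c fun i => hc i trivial, map_zero]
  have := congrArg (coeff α) hP
  rw [coeff_homogeneousComponent, if_pos rfl, coeff_zero, coeff_map] at this
  rw [eq_intCast] at this
  exact_mod_cast this

end Piece

end Multidegree

/-! ### Independence of the resolution and comparison of the two gradings -/

namespace Multidegree

open MvPolynomial

attribute [local instance] MvPolynomial.weightedGradedAlgebra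

/-- Both sides, divided by the same nonzero product, give the Hilbert series of `A/I` on the open
unit cube. -/
theorem GradedFreeResolution.kPoly_eq {σ τ k : Type*} [Field k] [Fintype σ] [Fintype τ]
    [DecidableEq τ] {w : σ → τ → ℤ} {I : Ideal (MvPolynomial σ k)}
    (F G : GradedFreeResolution w I) (hI : IsGradedIdeal w I) (hw : ∀ a, 0 < w a) :
    F.kPoly = G.kPoly := by
  refine eq_of_laurentEval_eq fun u hu hu1 => ?_
  have h := (F.hasSum_finrank_quotientPiece hI hw hu hu1).unique
    (G.hasSum_finrank_quotientPiece hI hw hu hu1)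
  refine mul_right_cancel₀ (Finset.prod_ne_zero_iff.2 fun a _ => ?_) h
  exact inv_ne_zero (sub_pos.2 (monomialValue_lt_one hu hu1 (hw a))).ne'

section Flip

variable {σ τ k : Type*} [Field k] {w w' : σ → τ → ℤ} {I : Ideal (MvPolynomial σ k)}
  {ε : τ → ℤˣ}

theorem weight_of_eq_signFlip (h : ∀ a, w' a = signFlip ε (w a)) (m : σ →₀ ℕ) :
    Finsupp.weight w' m = signFlip ε (Finsupp.weight w m) := by
  rw [Finsupp.weight_apply, Finsupp.weight_apply, map_finsuppSum]
  simp only [h, map_nsmul]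

theorem eq_signFlip_symm (h : ∀ a, w' a = signFlip ε (w a)) (a : σ) :
    w a = signFlip ε (w' a) := by
  rw [h, signFlip_signFlip]

theorem isWeightedHomogeneous_signFlip (h : ∀ a, w' a = signFlip ε (w a))
    {f : MvPolynomial σ k} {b : τ → ℤ} (hf : IsWeightedHomogeneous w f b) :
    IsWeightedHomogeneous w' f (signFlip ε b) := fun m hm => by
  rw [weight_of_eq_signFlip h, hf hm]

theorem weightedHomogeneousComponent_signFlip (h : ∀ a, w' a = signFlip ε (w a))
    (f : MvPolynomial σ k) (b : τ → ℤ) :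
    weightedHomogeneousComponent w' b f = weightedHomogeneousComponent w (signFlip ε b) f := by
  classical
  ext m
  rw [coeff_weightedHomogeneousComponent, coeff_weightedHomogeneousComponent,
    weight_of_eq_signFlip h]
  refine if_congr ⟨fun e => ?_, fun e => ?_⟩ rfl rfl
  · rw [← e, signFlip_signFlip]
  · rw [e, signFlip_signFlip]

theorem IsGradedIdeal.signFlip [Fintype τ] (h : ∀ a, w' a = signFlip ε (w a))
    (hI : IsGradedIdeal w I) :
    IsGradedIdeal w' I := by
  classical
  intro b f hf
  have := weightedHomogeneousComponent_mem_of_mem k w hI hf (Multidegree.signFlip ε b)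
  rw [← weightedHomogeneousComponent_signFlip h, ← weightedDecomposition.decompose'_apply] at this
  exact this

/-- A graded free resolution stays one when the signs of the degrees are changed. -/
def GradedFreeResolution.signFlip (h : ∀ a, w' a = signFlip ε (w a))
    (F : GradedFreeResolution w I) : GradedFreeResolution w' I where
  len := F.len
  rank := F.rank
  rank_eq_zero := F.rank_eq_zero
  shift i j := Multidegree.signFlip ε (F.shift i j)
  d := F.d
  aug := F.aug
  d_homogeneous i j l := by
    rw [← map_sub]
    exact isWeightedHomogeneous_signFlip h (F.d_homogeneous i j l)
  aug_homogeneous j := by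
    obtain ⟨f, hf, e⟩ := F.aug_homogeneous j
    exact ⟨f, isWeightedHomogeneous_signFlip h hf, e⟩
  aug_surjective := F.aug_surjective
  exact_zero := F.exact_zero
  exact_succ := F.exact_succ

theorem GradedFreeResolution.kPoly_signFlip (h : ∀ a, w' a = Multidegree.signFlip ε (w a))
    (F : GradedFreeResolution w I) : (F.signFlip h).kPoly = laurentFlip ε F.kPoly := by
  simp only [GradedFreeResolution.kPoly, map_sum, map_zsmul, laurentFlip_single]
  rfl

variable [Fintype τ]

theorem coeff_multidegree [Fintype σ] [DecidableEq τ] (β : τ →₀ ℕ) :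
    (multidegree w I).coeff β = if β.degree = codim I then
      MvPowerSeries.coeff β (substOneSub (kPolynomial w I)) else 0 := by
  rw [multidegree, coeff_homogeneousComponent]
  split_ifs with hβ
  · exact MvPowerSeries.coeff_truncTotal _ (hβ.trans_lt (Nat.lt_succ_self _))
  · rfl

theorem coeff_multidegree_signFlip [Fintype σ] [DecidableEq τ]
    (h : ∀ a, w' a = Multidegree.signFlip ε (w a))
    (hI : IsGradedIdeal w I) (hw : ∀ a, 0 < w a) (β : τ →₀ ℕ) :
    (multidegree w' I).coeff β =
      (multidegree w I).coeff β * β.prod fun i n => (ε i : ℤ) ^ n := by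
  rw [coeff_multidegree, coeff_multidegree]
  split_ifs with hβ
  swap
  · rw [zero_mul]
  by_cases hF : Nonempty (GradedFreeResolution w I)
  · have hG : Nonempty (GradedFreeResolution w' I) := hF.map fun F => F.signFlip h
    -- The resolutions chosen for `w` and `w'` are unrelated. The one for `w'` is flipped back to
    -- `w`, where positivity makes the K-polynomial unique.
    have hK : kPolynomial w' I = laurentFlip ε (kPolynomial w I) := by
      rw [kPolynomial, kPolynomial, dif_pos hF, dif_pos hG,
        ← GradedFreeResolution.kPoly_eq (hG.some.signFlip (eq_signFlip_symm h)) hF.some hI hw,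
        GradedFreeResolution.kPoly_signFlip, laurentFlip_laurentFlip]
    have hKF : kPolynomial w I = hF.some.kPoly := dif_pos hF
    obtain ⟨b, Q, hb, hQ⟩ := exists_eq_single_mul_polyOneSub (hF.some.kPoly)
    have hord := fun α hα =>
      hF.some.coeff_eq_zero_of_degree_lt_codim hI hw hb hQ (α := α) hα
    have h1 := coeff_substOneSub_laurentFlip 1 b hord hβ
    have h2 := coeff_substOneSub_laurentFlip ε b hord hβ
    rw [laurentFlip_one] at h1
    rw [hK, hKF, hQ, h2, h1]
    simp [Finsupp.prod]
  -- Resolutions exist for both gradings or for neither; in the latter case both K-polynomials take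
  -- the default value `0`, so the syzygy theorem is not needed.
  · have hG : ¬ Nonempty (GradedFreeResolution w' I) := fun hG =>
      hF (hG.map fun G => G.signFlip (eq_signFlip_symm h))
    rw [kPolynomial, kPolynomial, dif_neg hF, dif_neg hG]
    simp

end Flip

theorem degNeg_eq_signFlip (p : ℕ) (a : Fin p × Fin p) :
    degNeg p a = signFlip (sumSign p) (degPos p a) := by
  ext i
  cases i <;> simp [degNeg, degPos, signFlip_apply, sumSign]

theorem degPos_pos (p : ℕ) (a : Fin p × Fin p) : 0 < degPos p a := by
  refine Pi.lt_def.2 ⟨fun i => ?_, Sum.inl a.1, by simp [degPos]⟩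
  cases i <;> simp only [degPos, Sum.elim_inl, Sum.elim_inr, Pi.zero_apply, Pi.single_apply] <;>
    split_ifs <;> simp

end Multidegree

end

theorem mainTheorem5 {k : Type*} [Field k] (p : ℕ)
    (I : Ideal (MvPolynomial (Fin p × Fin p) k))
    (hI : Multidegree.IsGradedIdeal (Multidegree.degNeg p) I) :
    Multidegree.IsGradedIdeal (Multidegree.degPos p) I ∧
      Multidegree.multidegree (Multidegree.degNeg p) I =
        Multidegree.negS p (Multidegree.multidegree (Multidegree.degPos p) I) := by
  have h := Multidegree.degNeg_eq_signFlip p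
  have hpos := hI.signFlip (Multidegree.eq_signFlip_symm h)
  refine ⟨hpos, MvPolynomial.ext _ _ fun β => ?_⟩
  rw [Multidegree.coeff_negS,
    Multidegree.coeff_multidegree_signFlip h hpos (Multidegree.degPos_pos p)]
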